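/- Let $n\ge 1$ be an integer, $\gamma>0$, $\nu\in(0,1)$ and $c_\nu:=\nu^2-\tfrac14$; all functions are real-valued. Let $$\tilde H^2_0(-1,1):=\{f\in H^2(-1,1):\ f(0)=f'(0)=0\},$$ and let $D(A)$ be the set of all $f\in L^2(-1,1)$ that can be written as $f=f_r+f_s$ with $f_r\in\tilde H^2_0(-1,1)$ and $f_s\in L^2(-1,1)$ of the form $$f_s(x)=c_1^+|x|^{\nu+\frac12}+c_2^+|x|^{-\nu+\frac12}\ \text{ on }(0,1),\qquad f_s(x)=c_1^-|x|^{\nu+\frac12}+c_2^-|x|^{-\nu+\frac12}\ \text{ on }(-1,0),$$ where $c_1^\pm,c_2^\pm\in\mathbb R$, such that the boundary conditions $f(-1)=f(1)=0$ and the transmission conditions $$c_1^-+c_2^-+c_1^++c_2^+=0,\qquad (\nu+\tfrac12)c_1^-+(-\nu+\tfrac12)c_2^-=(\nu+\tfrac12)c_1^++(-\nu+\tfrac12)c_2^+$$ hold. For $f\in D(A)$ let $$A_nf:=-\partial_{xx}^2f+\frac{c_\nu}{x^2}f+(n\pi)^2|x|^{2\gamma}f,$$ the derivatives being weak derivatives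 on $(-1,0)\cup(0,1)$. Then $A_nf\in L^2(-1,1)$ for every $f\in D(A)$, and the operator $(A_n,D(A))$ is self-adjoint on $L^2(-1,1)$. Moreover, for every $f\in D(A)$ and every decomposition $f=f_r+f_s$ as above, $$\langle A_nf,f\rangle_{L^2(-1,1)}\ \ge\ m_\nu\int_{-1}^1\big(\partial_xf_r(x)\big)^2\,dx+(n\pi)^2\int_{-1}^1|x|^{2\gamma}f(x)^2\,dx,\qquad m_\nu:=\min\{1,4\nu^2\}.$$ -/

import Mathlib

open MeasureTheory Set Filter
open scoped ContDiff RealInnerProductSpace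

noncomputable section

namespace SingularGrushin

/-- Lebesgue measure on the interval `(-1, 1)`. -/
abbrev mu : Measure ℝ := volume.restrict (Ioo (-1 : ℝ) 1)

/-- The real Hilbert space `L²(-1, 1)`. -/
abbrev L2 : Type := Lp ℝ 2 mu

/-- `(-1, 0) ∪ (0, 1)`. -/
def punctured : Set ℝ := Ioo (-1 : ℝ) 0 ∪ Ioo (0 : ℝ) 1

/-- `g` is the weak derivative of `f` on the open set `U`; both are locally integrable on `U`. -/
structure HasWeakDerivOn (U : Set ℝ) (f g : ℝ → ℝ) : Prop where
  locInt : LocallyIntegrableOn f U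
  locInt_deriv : LocallyIntegrableOn g U
  integral_eq : ∀ φ : ℝ → ℝ, ContDiff ℝ ∞ φ → HasCompactSupport φ → tsupport φ ⊆ U →
    ∫ x in U, f x * deriv φ x = -∫ x in U, g x * φ x

/-- The point value at `x ∈ [-1, 1]` of a function on `(-1, 1)` given up to null sets is `v`:
some representative is continuous at `x` (from inside `[-1, 1]`) with value `v` there. -/
def HasPointValue (f : ℝ → ℝ) (x v : ℝ) : Prop :=
  ∃ F : ℝ → ℝ, f =ᵐ[mu] F ∧ ContinuousWithinAt F (Icc (-1) 1) x ∧ F x = v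

/-- `f ∈ H²(-1, 1)` with `f(0) = f'(0) = 0`; here `g` and `h` are the weak derivatives
`f'` and `f''`. -/
def MemH2Tilde (f : ℝ → ℝ) : Prop :=
  MemLp f 2 mu ∧ ∃ g h : ℝ → ℝ, MemLp g 2 mu ∧ MemLp h 2 mu ∧
    HasWeakDerivOn (Ioo (-1) 1) f g ∧ HasWeakDerivOn (Ioo (-1) 1) g h ∧
    HasPointValue f 0 0 ∧ HasPointValue g 0 0

/-- `f` is the function equal to `c₁⁺ |x|^(ν+1/2) + c₂⁺ |x|^(-ν+1/2)` on `(0, 1)` and to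
`c₁⁻ |x|^(ν+1/2) + c₂⁻ |x|^(-ν+1/2)` on `(-1, 0)`. -/
def IsSingular (ν : ℝ) (f : ℝ → ℝ) (c₁m c₂m c₁p c₂p : ℝ) : Prop :=
  (∀ᵐ x ∂(volume.restrict (Ioo (0 : ℝ) 1)),
    f x = c₁p * |x| ^ (ν + 1 / 2) + c₂p * |x| ^ (-ν + 1 / 2)) ∧
  (∀ᵐ x ∂(volume.restrict (Ioo (-1 : ℝ) 0)),
    f x = c₁m * |x| ^ (ν + 1 / 2) + c₂m * |x| ^ (-ν + 1 / 2))

/-- `f = f_r + f_s` is a decomposition of `f` into a regular and a singular part as in the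
definition of `D(A)`, with the Dirichlet conditions at `±1` and the transmission conditions. -/
structure IsDecomposition (ν : ℝ) (f fr fs : L2) (c₁m c₂m c₁p c₂p : ℝ) : Prop where
  sum_eq : f = fr + fs
  regular : MemH2Tilde fr
  singular : IsSingular ν fs c₁m c₂m c₁p c₂p
  left : HasPointValue f (-1) 0
  right : HasPointValue f 1 0
  transmission₁ : c₁m + c₂m + c₁p + c₂p = 0
  transmission₂ : (ν + 1 / 2) * c₁m + (-ν + 1 / 2) * c₂m =
    (ν + 1 / 2) * c₁p + (-ν + 1 / 2) * c₂p

/-- `u = -f'' + (c_ν / x²) f + (nπ)² |x|^(2γ) f` with `c_ν = ν² - 1/4`, the derivatives `g = f'` and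
`h = f''` being taken in the weak sense on `(-1, 0) ∪ (0, 1)`. -/
def IsDiffExpr (n : ℕ) (γ ν : ℝ) (f u : ℝ → ℝ) : Prop :=
  ∃ g h : ℝ → ℝ, HasWeakDerivOn punctured f g ∧ HasWeakDerivOn punctured g h ∧
    u =ᵐ[mu] fun x => -h x + (ν ^ 2 - 1 / 4) / x ^ 2 * f x +
      (n * Real.pi) ^ 2 * |x| ^ (2 * γ) * f x

/-! ### Linearity of the notions above -/

theorem integrableOn_mul_test {U : Set ℝ} {f ψ : ℝ → ℝ}
    (hf : LocallyIntegrableOn f U) (hψ : Continuous ψ) (hc : HasCompactSupport ψ)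
    (hs : tsupport ψ ⊆ U) : IntegrableOn (fun x => f x * ψ x) U := by
  have h1 : IntegrableOn (fun x => f x * ψ x) (tsupport ψ) :=
    (hf.integrableOn_compact_subset hs hc).mul_continuousOn hψ.continuousOn hc
  have h2 : Integrable (fun x => f x * ψ x) := by
    refine (integrableOn_iff_integrable_of_support_subset ?_).mp h1
    intro x hx
    refine subset_tsupport ψ ?_
    intro h
    exact hx (by simp [h])
  exact h2.integrableOn

theorem HasWeakDerivOn.add {U : Set ℝ} {f₁ f₂ g₁ g₂ : ℝ → ℝ} (h₁ : HasWeakDerivOn U f₁ g₁)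
    (h₂ : HasWeakDerivOn U f₂ g₂) : HasWeakDerivOn U (f₁ + f₂) (g₁ + g₂) where
  locInt := h₁.locInt.add h₂.locInt
  locInt_deriv := h₁.locInt_deriv.add h₂.locInt_deriv
  integral_eq φ hφ hc hs := by
    have hd : Continuous (deriv φ) := hφ.continuous_deriv (by simp)
    have hs' : tsupport (deriv φ) ⊆ U :=
      (closure_minimal (support_deriv_subset) (isClosed_tsupport _)).trans hs
    simp only [Pi.add_apply, add_mul]
    rw [integral_add (integrableOn_mul_test h₁.locInt hd hc.deriv hs')
        (integrableOn_mul_test h₂.locInt hd hc.deriv hs'),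
      integral_add (integrableOn_mul_test h₁.locInt_deriv hφ.continuous hc hs)
        (integrableOn_mul_test h₂.locInt_deriv hφ.continuous hc hs),
      h₁.integral_eq φ hφ hc hs, h₂.integral_eq φ hφ hc hs, neg_add]

theorem HasWeakDerivOn.smul {U : Set ℝ} {f g : ℝ → ℝ} (c : ℝ) (h : HasWeakDerivOn U f g) :
    HasWeakDerivOn U (c • f) (c • g) where
  locInt := h.locInt.smul c
  locInt_deriv := h.locInt_deriv.smul c
  integral_eq φ hφ hc hs := by
    simp only [Pi.smul_apply, smul_eq_mul, mul_assoc]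
    rw [integral_const_mul, integral_const_mul, h.integral_eq φ hφ hc hs, mul_neg]

theorem locallyIntegrableOn_congr {U : Set ℝ} {f f' : ℝ → ℝ}
    (hf : f =ᵐ[volume.restrict U] f') (h : LocallyIntegrableOn f U) :
    LocallyIntegrableOn f' U := by
  intro x hx
  obtain ⟨s, hs, hi⟩ := h x hx
  refine ⟨s ∩ U, inter_mem hs self_mem_nhdsWithin, ?_⟩
  have hae : f =ᵐ[volume.restrict (s ∩ U)] f' :=
    ae_mono (Measure.restrict_mono inter_subset_right le_rfl) hf
  exact IntegrableOn.congr_fun_ae (hi.mono_set inter_subset_left) hae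

theorem HasWeakDerivOn.congr_left {U : Set ℝ} {f f' g : ℝ → ℝ}
    (hf : f =ᵐ[volume.restrict U] f') (h : HasWeakDerivOn U f g) : HasWeakDerivOn U f' g where
  locInt := locallyIntegrableOn_congr hf h.locInt
  locInt_deriv := h.locInt_deriv
  integral_eq φ hφ hc hs := by
    rw [← h.integral_eq φ hφ hc hs]
    refine integral_congr_ae ?_
    filter_upwards [hf] with x hx
    rw [hx]

theorem HasPointValue.add {f g : ℝ → ℝ} {x v w : ℝ} (hf : HasPointValue f x v)
    (hg : HasPointValue g x w) : HasPointValue (f + g) x (v + w) := by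
  obtain ⟨F, h1, h2, h3⟩ := hf
  obtain ⟨G, k1, k2, k3⟩ := hg
  exact ⟨F + G, h1.add k1, h2.add k2, by simp [h3, k3]⟩

theorem HasPointValue.smul {f : ℝ → ℝ} {x v : ℝ} (c : ℝ) (hf : HasPointValue f x v) :
    HasPointValue (c • f) x (c * v) := by
  obtain ⟨F, h1, h2, h3⟩ := hf
  exact ⟨c • F, h1.const_smul c, h2.const_smul c, by simp [h3]⟩

theorem HasPointValue.congr {f f' : ℝ → ℝ} {x v : ℝ} (h : f =ᵐ[mu] f')
    (hf : HasPointValue f x v) : HasPointValue f' x v := by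
  obtain ⟨F, h1, h2, h3⟩ := hf
  exact ⟨F, h.symm.trans h1, h2, h3⟩

theorem hasPointValue_zero (x : ℝ) : HasPointValue (0 : ℝ → ℝ) x 0 :=
  ⟨0, EventuallyEq.rfl, continuousWithinAt_const, rfl⟩

theorem hasWeakDerivOn_zero (U : Set ℝ) : HasWeakDerivOn U (0 : ℝ → ℝ) 0 where
  locInt := locallyIntegrableOn_zero
  locInt_deriv := locallyIntegrableOn_zero
  integral_eq φ _ _ _ := by simp

theorem MemH2Tilde.congr {f f' : ℝ → ℝ} (h : f =ᵐ[mu] f') (hf : MemH2Tilde f) :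
    MemH2Tilde f' := by
  obtain ⟨h0, g, k, h1, h2, h3, h4, h5, h6⟩ := hf
  exact ⟨(memLp_congr_ae h).mp h0, g, k, h1, h2, h3.congr_left h, h4,
    h5.congr h, h6⟩

theorem MemH2Tilde.add {f f' : ℝ → ℝ} (hf : MemH2Tilde f) (hf' : MemH2Tilde f') :
    MemH2Tilde (f + f') := by
  obtain ⟨h0, g, k, h1, h2, h3, h4, h5, h6⟩ := hf
  obtain ⟨h0', g', k', h1', h2', h3', h4', h5', h6'⟩ := hf'
  exact ⟨h0.add h0', g + g', k + k', h1.add h1', h2.add h2', h3.add h3', h4.add h4',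
    by simpa using h5.add h5', by simpa using h6.add h6'⟩

theorem MemH2Tilde.smul {f : ℝ → ℝ} (c : ℝ) (hf : MemH2Tilde f) : MemH2Tilde (c • f) := by
  obtain ⟨h0, g, k, h1, h2, h3, h4, h5, h6⟩ := hf
  exact ⟨h0.const_smul c, c • g, c • k, h1.const_smul c, h2.const_smul c, h3.smul c, h4.smul c,
    by simpa using h5.smul c, by simpa using h6.smul c⟩

theorem memH2Tilde_zero : MemH2Tilde (0 : ℝ → ℝ) :=
  ⟨MemLp.zero, 0, 0, MemLp.zero, MemLp.zero, hasWeakDerivOn_zero _, hasWeakDerivOn_zero _,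
    hasPointValue_zero 0, hasPointValue_zero 0⟩

theorem ae_right {p : ℝ → Prop} (h : ∀ᵐ x ∂mu, p x) :
    ∀ᵐ x ∂(volume.restrict (Ioo (0 : ℝ) 1)), p x :=
  ae_mono (Measure.restrict_mono (Ioo_subset_Ioo_left (by norm_num)) le_rfl) h

theorem ae_left {p : ℝ → Prop} (h : ∀ᵐ x ∂mu, p x) :
    ∀ᵐ x ∂(volume.restrict (Ioo (-1 : ℝ) 0)), p x :=
  ae_mono (Measure.restrict_mono (Ioo_subset_Ioo_right (by norm_num)) le_rfl) h

theorem ae_punctured {p : ℝ → Prop} (h : ∀ᵐ x ∂mu, p x) :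
    ∀ᵐ x ∂(volume.restrict punctured), p x := by
  refine ae_mono (Measure.restrict_mono ?_ le_rfl) h
  exact union_subset (Ioo_subset_Ioo_right (by norm_num)) (Ioo_subset_Ioo_left (by norm_num))

theorem IsDecomposition.add {ν : ℝ} {f fr fs f' fr' fs' : L2} {a b c d a' b' c' d' : ℝ}
    (h : IsDecomposition ν f fr fs a b c d) (h' : IsDecomposition ν f' fr' fs' a' b' c' d') :
    IsDecomposition ν (f + f') (fr + fr') (fs + fs') (a + a') (b + b') (c + c') (d + d') where
  sum_eq := by rw [h.sum_eq, h'.sum_eq]; abel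
  regular := (h.regular.add h'.regular).congr (Lp.coeFn_add fr fr').symm
  singular := by
    refine ⟨?_, ?_⟩
    · filter_upwards [ae_right (Lp.coeFn_add fs fs'), h.singular.1, h'.singular.1] with x h1 h2 h3
      rw [h1, Pi.add_apply, h2, h3]; ring
    · filter_upwards [ae_left (Lp.coeFn_add fs fs'), h.singular.2, h'.singular.2] with x h1 h2 h3
      rw [h1, Pi.add_apply, h2, h3]; ring
  left := by simpa using (h.left.add h'.left).congr (Lp.coeFn_add f f').symm
  right := by simpa using (h.right.add h'.right).congr (Lp.coeFn_add f f').symm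
  transmission₁ := by linear_combination h.transmission₁ + h'.transmission₁
  transmission₂ := by linear_combination h.transmission₂ + h'.transmission₂

theorem IsDecomposition.smul {ν : ℝ} {f fr fs : L2} {a b c d : ℝ} (t : ℝ)
    (h : IsDecomposition ν f fr fs a b c d) :
    IsDecomposition ν (t • f) (t • fr) (t • fs) (t * a) (t * b) (t * c) (t * d) where
  sum_eq := by rw [h.sum_eq, smul_add]
  regular := (h.regular.smul t).congr (Lp.coeFn_smul t fr).symm
  singular := by
    refine ⟨?_, ?_⟩
    · filter_upwards [ae_right (Lp.coeFn_smul t fs), h.singular.1] with x h1 h2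
      rw [h1, Pi.smul_apply, h2, smul_eq_mul]; ring
    · filter_upwards [ae_left (Lp.coeFn_smul t fs), h.singular.2] with x h1 h2
      rw [h1, Pi.smul_apply, h2, smul_eq_mul]; ring
  left := by simpa using (h.left.smul t).congr (Lp.coeFn_smul t f).symm
  right := by simpa using (h.right.smul t).congr (Lp.coeFn_smul t f).symm
  transmission₁ := by linear_combination t * h.transmission₁
  transmission₂ := by linear_combination t * h.transmission₂

theorem isDecomposition_zero (ν : ℝ) : IsDecomposition ν 0 0 0 0 0 0 0 where
  sum_eq := by simp
  regular := memH2Tilde_zero.congr (Lp.coeFn_zero ℝ 2 mu).symm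
  singular := by
    refine ⟨?_, ?_⟩
    · filter_upwards [ae_right (Lp.coeFn_zero ℝ 2 mu)] with x h1
      rw [h1]; simp
    · filter_upwards [ae_left (Lp.coeFn_zero ℝ 2 mu)] with x h1
      rw [h1]; simp
  left := (hasPointValue_zero (-1)).congr (Lp.coeFn_zero ℝ 2 mu).symm
  right := (hasPointValue_zero 1).congr (Lp.coeFn_zero ℝ 2 mu).symm
  transmission₁ := by simp
  transmission₂ := by simp

theorem IsDiffExpr.congr {n : ℕ} {γ ν : ℝ} {f f' u u' : ℝ → ℝ} (hf : f =ᵐ[mu] f')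
    (hu : u =ᵐ[mu] u') (h : IsDiffExpr n γ ν f u) : IsDiffExpr n γ ν f' u' := by
  obtain ⟨g, k, h1, h2, h3⟩ := h
  refine ⟨g, k, h1.congr_left (ae_punctured hf), h2, ?_⟩
  filter_upwards [hf, hu, h3] with x e1 e2 e3
  rw [← e2, e3, e1]

theorem IsDiffExpr.add {n : ℕ} {γ ν : ℝ} {f f' u u' : ℝ → ℝ}
    (h : IsDiffExpr n γ ν f u) (h' : IsDiffExpr n γ ν f' u') :
    IsDiffExpr n γ ν (f + f') (u + u') := by
  obtain ⟨g, k, h1, h2, h3⟩ := h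
  obtain ⟨g', k', h1', h2', h3'⟩ := h'
  refine ⟨g + g', k + k', h1.add h1', h2.add h2', ?_⟩
  filter_upwards [h3, h3'] with x e1 e2
  simp only [Pi.add_apply]
  rw [e1, e2]; ring

theorem IsDiffExpr.smul {n : ℕ} {γ ν : ℝ} {f u : ℝ → ℝ} (t : ℝ)
    (h : IsDiffExpr n γ ν f u) : IsDiffExpr n γ ν (t • f) (t • u) := by
  obtain ⟨g, k, h1, h2, h3⟩ := h
  refine ⟨t • g, t • k, h1.smul t, h2.smul t, ?_⟩
  filter_upwards [h3] with x e1
  simp only [Pi.smul_apply, smul_eq_mul]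
  rw [e1]; ring

theorem isDiffExpr_zero (n : ℕ) (γ ν : ℝ) : IsDiffExpr n γ ν 0 0 :=
  ⟨0, 0, hasWeakDerivOn_zero _, hasWeakDerivOn_zero _, by simp; rfl⟩

/-! ### The operator -/

/-- The domain `D(A)`, a subspace of `L²(-1, 1)`. -/
def domainA (ν : ℝ) : Submodule ℝ L2 where
  carrier := {f | ∃ (fr fs : L2) (c₁m c₂m c₁p c₂p : ℝ),
    IsDecomposition ν f fr fs c₁m c₂m c₁p c₂p}
  zero_mem' := ⟨0, 0, 0, 0, 0, 0, isDecomposition_zero ν⟩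
  add_mem' := by
    rintro f f' ⟨_, _, _, _, _, _, h⟩ ⟨_, _, _, _, _, _, h'⟩
    exact ⟨_, _, _, _, _, _, h.add h'⟩
  smul_mem' := by
    rintro t f ⟨_, _, _, _, _, _, h⟩
    exact ⟨_, _, _, _, _, _, h.smul t⟩

/-- The graph of `A_n`: all pairs `(f, u)` in `L² × L²` with `f ∈ D(A)` and
`u = -f'' + (c_ν / x²) f + (nπ)² |x|^(2γ) f` on `(-1, 0) ∪ (0, 1)`. -/
def graphA (n : ℕ) (γ ν : ℝ) : Submodule ℝ (L2 × L2) where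
  carrier := {p | p.1 ∈ domainA ν ∧ IsDiffExpr n γ ν p.1 p.2}
  zero_mem' := ⟨zero_mem _, (isDiffExpr_zero n γ ν).congr (Lp.coeFn_zero ℝ 2 mu).symm
    (Lp.coeFn_zero ℝ 2 mu).symm⟩
  add_mem' := by
    rintro p q ⟨h1, h2⟩ ⟨k1, k2⟩
    exact ⟨add_mem h1 k1, (h2.add k2).congr (Lp.coeFn_add p.1 q.1).symm
      (Lp.coeFn_add p.2 q.2).symm⟩
  smul_mem' := by
    rintro t p ⟨h1, h2⟩
    exact ⟨Submodule.smul_mem _ t h1, (h2.smul t).congr (Lp.coeFn_smul t p.1).symm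
      (Lp.coeFn_smul t p.2).symm⟩

/-- The unbounded operator `A_n` in `L²(-1, 1)`. -/
def operatorA (n : ℕ) (γ ν : ℝ) : L2 →ₗ.[ℝ] L2 := (graphA n γ ν).toLinearPMap

end SingularGrushin

end

/-! Write `A_n = T + V` with `T = -∂² + c_ν / x²` and `V = (nπ)² |x|^(2γ)`. On `(-1, 1)` the
potential `V` is bounded and symmetric, so everything reduces to `T`.

A regular part is exactly a double primitive from `0`, `R = prim (prim h)` with `h ∈ L²`. Both
exponents `s = ±ν + 1/2` satisfy `s (s - 1) = c_ν`, so singular parts are annihilated by `T` off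
`0`, and `T f = -h + (c_ν / x²) R`. Two applications of the weighted Hardy inequality
`lintegral_hardy_le` put `R / x²` in `L²`; hence `A_n f ∈ L²`.

Green's formula (`integral_expr_mul` on each half, `IsRepr.integral_expr_mul` on the whole
interval): the bounds `R' = O(x^(1/2))` and `R = O(x^(3/2))` kill the boundary terms at `0`. The
Dirichlet conditions remove the terms in `R'(±1)`. The rest is `R(1)` and `R(-1)` times the two
sides of the second transmission condition of the test function, and `R(1) + R(-1) = 0` by the first
transmission condition. Only the form `∫ R' K' + c_ν R K / x²` in the regular parts `R`, `K`
survives. It is symmetric, and `∫ R² / x² ≤ 4 ∫ R'²` bounds it below by `min 1 (4ν²) ∫ R'²`, which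
is the coercivity.

Self-adjointness needs a range statement besides symmetry. The function `|x|^(ν+1/2) - |x|^(-ν+1/2)`
lies in the kernel of `T`. Variation of constants solves `T f = w` on each half; the boundary and
transmission conditions can then be met as soon as `R(1) + R(-1) = 0`, and this is orthogonality of
`w` to that kernel function (`exists_isRepr_of_integral_kernelFun_eq_zero`). The abstract criterion
`isSelfAdjoint_of_symmetric_of_range` concludes. The assumption `ν < 1` makes both exponents exceed
`-1/2`, as square integrability and Hardy require; `ν > 0` makes them distinct. -/

noncomputable section

namespace SingularGrushin

open Topology

/-! ### Primitives of locally integrable functions -/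

/-- The primitive of `h` vanishing at `0`. -/
def prim (h : ℝ → ℝ) (x : ℝ) : ℝ := ∫ t in (0 : ℝ)..x, h t

theorem prim_zero (h : ℝ → ℝ) : prim h 0 = 0 := by simp [prim]

theorem intervalIntegrable_of_locallyIntegrable {h : ℝ → ℝ} (hh : LocallyIntegrable h) (a b : ℝ) :
    IntervalIntegrable h volume a b :=
  (hh.integrableOn_isCompact isCompact_uIcc).intervalIntegrable

theorem absolutelyContinuousOnInterval_prim {h : ℝ → ℝ} (hh : LocallyIntegrable h) (a b : ℝ) :
    AbsolutelyContinuousOnInterval (prim h) a b := by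
  have h0 : (0 : ℝ) ∈ uIcc (-(|a| + |b|)) (|a| + |b|) := by
    rw [mem_uIcc]; left; constructor <;> linarith [abs_nonneg a, abs_nonneg b]
  refine ((intervalIntegrable_of_locallyIntegrable hh
    _ _).absolutelyContinuousOnInterval_intervalIntegral h0).mono ?_
  rw [uIcc_of_le (a := -(|a| + |b|)) (by linarith [abs_nonneg a, abs_nonneg b])]
  refine uIcc_subset_Icc ⟨?_, ?_⟩ ⟨?_, ?_⟩ <;>
    linarith [abs_nonneg a, abs_nonneg b, le_abs_self a, le_abs_self b, neg_abs_le a, neg_abs_le b]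

theorem ae_hasDerivAt_prim {h : ℝ → ℝ} (hh : LocallyIntegrable h) :
    ∀ᵐ x, HasDerivAt (prim h) (h x) x := by
  filter_upwards [_root_.LocallyIntegrable.ae_hasDerivAt_integral hh] with x hx
  exact hx 0

theorem continuous_prim {h : ℝ → ℝ} (hh : LocallyIntegrable h) : Continuous (prim h) :=
  intervalIntegral.continuous_primitive (intervalIntegrable_of_locallyIntegrable hh) 0

theorem hasDerivAt_prim {h : ℝ → ℝ} (hh : Continuous h) (x : ℝ) :
    HasDerivAt (prim h) (h x) x :=
  hh.integral_hasStrictDerivAt 0 x |>.hasDerivAt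

theorem prim_comp_neg (h : ℝ → ℝ) (x : ℝ) : prim (fun t => h (-t)) x = -prim h (-x) := by
  unfold prim
  rw [intervalIntegral.integral_comp_neg, neg_zero, intervalIntegral.integral_symm]

/-- Each primitive contributes one sign under reflection. This reduces every statement on `(-1, 0)`
to one on `(0, 1)`. -/
theorem prim_prim_comp_neg (h : ℝ → ℝ) (x : ℝ) :
    prim (prim fun t => h (-t)) x = prim (prim h) (-x) := by
  rw [show prim (fun t => h (-t)) = fun x => -prim h (-x) from funext (prim_comp_neg h)]
  have := prim_comp_neg (fun t => -prim h t) x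
  rw [this]
  unfold prim
  rw [intervalIntegral.integral_neg, neg_neg]

theorem integral_eq_sub_of_ae_hasDerivAt {F f : ℝ → ℝ} {a b : ℝ}
    (hF : AbsolutelyContinuousOnInterval F a b)
    (hd : ∀ᵐ x, x ∈ uIcc a b → HasDerivAt F (f x) x) : ∫ x in a..b, f x = F b - F a := by
  rw [← hF.integral_deriv_eq_sub]
  refine intervalIntegral.integral_congr_ae ?_
  filter_upwards [hd] with x hx h
  exact (hx (uIoc_subset_uIcc h)).deriv.symm

/-! ### Weak derivatives -/

theorem setIntegral_mul_test {U : Set ℝ} {ψ : ℝ → ℝ} (f : ℝ → ℝ) (hs : tsupport ψ ⊆ U) :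
    ∫ x in U, f x * ψ x = ∫ x, f x * ψ x := by
  refine setIntegral_eq_integral_of_forall_compl_eq_zero fun x hx => ?_
  rw [image_eq_zero_of_notMem_tsupport (fun h => hx (hs h)), mul_zero]

theorem tsupport_deriv_subset_tsupport {φ : ℝ → ℝ} : tsupport (deriv φ) ⊆ tsupport φ :=
  closure_minimal support_deriv_subset (isClosed_tsupport _)

theorem HasCompactSupport.exists_subset_Ioo {φ : ℝ → ℝ} (hc : HasCompactSupport φ) :
    ∃ M : ℝ, 0 < M ∧ tsupport φ ⊆ Ioo (-M) M := by
  obtain ⟨M, hM⟩ := (Metric.isBounded_iff_subset_ball (0 : ℝ)).mp hc.isCompact.isBounded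
  refine ⟨max M 1, by positivity, fun x hx => ?_⟩
  have := hM hx
  rw [mem_ball_zero_iff, Real.norm_eq_abs, abs_lt] at this
  constructor <;> linarith [le_max_left M 1]

theorem hasWeakDerivOn_prim {h : ℝ → ℝ} (hh : LocallyIntegrable h) (U : Set ℝ) :
    HasWeakDerivOn U (prim h) h where
  locInt := (continuous_prim hh).locallyIntegrable.locallyIntegrableOn U
  locInt_deriv := hh.locallyIntegrableOn U
  integral_eq φ hφ hc hs := by
    rw [setIntegral_mul_test _ hs, setIntegral_mul_test _ (tsupport_deriv_subset_tsupport.trans hs)]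
    obtain ⟨M, hM, hsM⟩ := HasCompactSupport.exists_subset_Ioo hc
    have key : ∀ (f ψ : ℝ → ℝ), tsupport ψ ⊆ Ioo (-M) M →
        ∫ x, f x * ψ x = ∫ x in (-M)..M, f x * ψ x := by
      intro f ψ hψ
      refine (intervalIntegral.integral_eq_integral_of_support_subset fun x hx => ?_).symm
      exact Ioo_subset_Ioc_self (hψ (subset_tsupport _ (right_ne_zero_of_mul hx)))
    rw [key _ _ hsM, key _ _ (tsupport_deriv_subset_tsupport.trans hsM)]
    have hφM : φ M = 0 := image_eq_zero_of_notMem_tsupport fun h => (hsM h).2.false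
    have hφm : φ (-M) = 0 := image_eq_zero_of_notMem_tsupport fun h => (hsM h).1.false
    rw [(absolutelyContinuousOnInterval_prim hh (-M) M).integral_mul_deriv_eq_deriv_mul
      ((hφ.of_le (by simp)).contDiffOn.absolutelyContinuousOnInterval), hφM, hφm]
    simp only [mul_zero, sub_zero, zero_sub]
    congr 1
    refine intervalIntegral.integral_congr_ae ?_
    filter_upwards [ae_hasDerivAt_prim hh] with x hx _
    rw [hx.deriv]

theorem hasWeakDerivOn_of_hasDerivAt {U : Set ℝ} (hU : IsOpen U) {f f' : ℝ → ℝ}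
    (hd : ∀ x ∈ U, HasDerivAt f (f' x) x) (hf' : ContinuousOn f' U) : HasWeakDerivOn U f f' where
  locInt := ContinuousOn.locallyIntegrableOn
    (fun x hx => (hd x hx).continuousAt.continuousWithinAt) hU.measurableSet
  locInt_deriv := hf'.locallyIntegrableOn hU.measurableSet
  integral_eq φ hφ hc hs := by
    have hfc : ContinuousOn f U := fun x hx => (hd x hx).continuousAt.continuousWithinAt
    have hφ' : Continuous (deriv φ) := hφ.continuous_deriv (by simp)
    have hs' : tsupport (deriv φ) ⊆ U := tsupport_deriv_subset_tsupport.trans hs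
    have i1 := integrableOn_mul_test (hfc.locallyIntegrableOn hU.measurableSet) hφ' hc.deriv hs'
    have i2 := integrableOn_mul_test (hf'.locallyIntegrableOn hU.measurableSet)
      hφ.continuous hc hs
    have glob : ∀ (g ψ : ℝ → ℝ), tsupport ψ ⊆ U → IntegrableOn (fun x => g x * ψ x) U →
        Integrable fun x => g x * ψ x := by
      intro g ψ hψ hi
      refine (integrableOn_iff_integrable_of_support_subset fun x hx => ?_).mp hi
      exact hψ (subset_tsupport _ (right_ne_zero_of_mul hx))
    have j1 := glob _ _ hs' i1
    have j2 := glob _ _ hs i2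
    rw [setIntegral_mul_test _ hs, setIntegral_mul_test _ hs']
    -- The product is differentiable on the whole line: off the support of `φ` it vanishes locally,
    -- whatever `f` does there.
    have hder : ∀ x, HasDerivAt (fun x => f x * φ x) (f' x * φ x + f x * deriv φ x) x := by
      intro x
      by_cases hx : x ∈ tsupport φ
      · exact (hd x (hs hx)).mul (hφ.differentiable (by simp) x).hasDerivAt
      · have e : φ =ᶠ[𝓝 x] 0 := notMem_tsupport_iff_eventuallyEq.mp hx
        have e1 : (fun x => f x * φ x) =ᶠ[𝓝 x] fun _ => 0 := by
          filter_upwards [e] with y hy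
          simp [hy]
        have e2 : φ x = 0 := image_eq_zero_of_notMem_tsupport hx
        have e3 : deriv φ x = 0 :=
          image_eq_zero_of_notMem_tsupport fun h => hx (tsupport_deriv_subset_tsupport h)
        rw [e2, e3]
        simpa using (hasDerivAt_const x (0 : ℝ)).congr_of_eventuallyEq e1
    have hint : Integrable fun x => f x * φ x := by
      refine glob _ _ hs ?_
      exact integrableOn_mul_test (hfc.locallyIntegrableOn hU.measurableSet) hφ.continuous hc hs
    have := integral_eq_zero_of_hasDerivAt_of_integrable hder (j2.add j1) hint
    rw [integral_add j2 j1] at this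
    linarith

theorem HasWeakDerivOn.congr_right {U : Set ℝ} {f g g' : ℝ → ℝ}
    (hg : g =ᵐ[volume.restrict U] g') (h : HasWeakDerivOn U f g) : HasWeakDerivOn U f g' where
  locInt := h.locInt
  locInt_deriv := locallyIntegrableOn_congr hg h.locInt_deriv
  integral_eq φ hφ hc hs := by
    rw [h.integral_eq φ hφ hc hs]
    congr 1
    refine integral_congr_ae ?_
    filter_upwards [hg] with x hx
    rw [hx]

theorem HasWeakDerivOn.sub {U : Set ℝ} {f₁ f₂ g₁ g₂ : ℝ → ℝ} (h₁ : HasWeakDerivOn U f₁ g₁)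
    (h₂ : HasWeakDerivOn U f₂ g₂) : HasWeakDerivOn U (f₁ - f₂) (g₁ - g₂) := by
  have := h₁.add (h₂.smul (-1))
  rwa [neg_one_smul, neg_one_smul, ← sub_eq_add_neg, ← sub_eq_add_neg] at this

theorem HasWeakDerivOn.ae_eq {U : Set ℝ} (hU : IsOpen U) {f f' g g' : ℝ → ℝ}
    (h : HasWeakDerivOn U f g) (h' : HasWeakDerivOn U f' g') (hf : f =ᵐ[volume.restrict U] f') :
    g =ᵐ[volume.restrict U] g' := by
  have h2 := ((h.congr_left hf).sub h').locInt_deriv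
  have := hU.ae_eq_zero_of_integral_contDiff_smul_eq_zero h2 (fun φ hφ hc hs => ?_)
  · rw [EventuallyEq, ae_restrict_iff' hU.measurableSet]
    filter_upwards [this] with x hx hxU
    exact sub_eq_zero.mp (hx hxU)
  · have h3 := ((h.congr_left hf).sub h').integral_eq φ hφ hc hs
    rw [setIntegral_mul_test _ hs] at h3
    simp only [sub_self, Pi.zero_apply, zero_mul, integral_zero] at h3
    simp only [smul_eq_mul, mul_comm (φ _)]
    linarith

/-- The du Bois-Reymond argument: any test function, minus its integral times a fixed bump `ρ` of
mass one, is the derivative of a test function. So `k` pairs with every test function as the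
constant `∫ k ρ` does. -/
theorem exists_ae_eq_const_of_hasWeakDerivOn_zero {k : ℝ → ℝ}
    (hk : HasWeakDerivOn (Ioo (-1) 1) k 0) : ∃ C : ℝ, k =ᵐ[mu] fun _ => C := by
  set b : ContDiffBump (0 : ℝ) := ⟨1 / 4, 1 / 2, by norm_num, by norm_num⟩ with hb
  set ρ : ℝ → ℝ := b.normed volume with hρ
  have ρs : ContDiff ℝ ∞ ρ := b.contDiff_normed
  have ρc : HasCompactSupport ρ := b.hasCompactSupport_normed
  have ρt : tsupport ρ ⊆ Ioo (-1) 1 := by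
    rw [hρ, b.tsupport_normed_eq, Real.closedBall_eq_Icc]
    intro x hx
    have h1 : -(1 / 2 : ℝ) ≤ x := by simpa [hb] using hx.1
    have h2 : x ≤ (1 / 2 : ℝ) := by simpa [hb] using hx.2
    constructor <;> linarith
  have ρi : ∫ x, ρ x = 1 := b.integral_normed
  refine ⟨∫ x in Ioo (-1) 1, k x * ρ x, ?_⟩
  set C := ∫ x in Ioo (-1 : ℝ) 1, k x * ρ x with hC
  have hloc : LocallyIntegrableOn (fun x => k x - C) (Ioo (-1 : ℝ) 1) :=
    hk.locInt.sub (continuous_const.locallyIntegrable.locallyIntegrableOn _)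
  have := isOpen_Ioo.ae_eq_zero_of_integral_contDiff_smul_eq_zero hloc (fun ψ ψs ψc ψt => ?_)
  · rw [EventuallyEq, ae_restrict_iff' measurableSet_Ioo]
    filter_upwards [this] with x hx hxU
    exact sub_eq_zero.mp (hx hxU)
  set θ : ℝ → ℝ := fun x => ψ x - (∫ y, ψ y) * ρ x with hθ
  have θs : ContDiff ℝ ∞ θ := ψs.sub (contDiff_const.mul ρs)
  have θsupp : tsupport θ ⊆ tsupport ψ ∪ tsupport ρ := by
    refine closure_minimal (fun x hx => ?_) ((isClosed_tsupport _).union (isClosed_tsupport _))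
    by_contra hcon
    rw [mem_union, not_or] at hcon
    apply hx
    simp [hθ, image_eq_zero_of_notMem_tsupport hcon.1, image_eq_zero_of_notMem_tsupport hcon.2]
  have ψi : Integrable ψ := ψs.continuous.integrable_of_hasCompactSupport ψc
  have ρint : Integrable ρ := ρs.continuous.integrable_of_hasCompactSupport ρc
  have θi : ∫ x, θ x = 0 := by
    simp only [hθ]
    rw [integral_sub ψi (ρint.const_mul _), integral_const_mul, ρi]; ring
  -- The primitive of `θ` need not vanish in gaps of the support of `θ`, so a symmetric interval
  -- around that support is needed. Inserting `0` keeps the compact set nonempty.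
  obtain ⟨r, hr1, hr⟩ : ∃ r : ℝ, r < 1 ∧ tsupport θ ⊆ Icc (-r) r := by
    have hK : IsCompact (insert (0 : ℝ) (tsupport ψ ∪ tsupport ρ)) :=
      (ψc.isCompact.union ρc.isCompact).insert 0
    obtain ⟨x₀, hx₀, hmax⟩ := hK.exists_isMaxOn ⟨0, mem_insert _ _⟩ continuous_abs.continuousOn
    refine ⟨|x₀|, ?_, fun x hx => ?_⟩
    · have : x₀ ∈ Ioo (-1 : ℝ) 1 := by
        rcases hx₀ with rfl | h | h
        · simp
        · exact ψt h
        · exact ρt h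
      rw [abs_lt]; exact this
    · have : |x| ≤ |x₀| := hmax (mem_insert_of_mem _ (θsupp hx))
      exact abs_le.mp this
  set φ : ℝ → ℝ := fun x => ∫ t in (-1 : ℝ)..x, θ t with hφ
  have φd : ∀ x, HasDerivAt φ (θ x) x := fun x =>
    (θs.continuous.integral_hasStrictDerivAt (-1) x).hasDerivAt
  have φde : deriv φ = θ := funext fun x => (φd x).deriv
  have φs : ContDiff ℝ ∞ φ := by
    rw [contDiff_infty_iff_deriv, φde]
    exact ⟨fun x => (φd x).differentiableAt, θs⟩
  have φt : tsupport φ ⊆ Icc (-r) r := by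
    refine closure_minimal (fun x hx => ?_) isClosed_Icc
    by_contra hcon
    apply hx
    rw [mem_Icc, not_and_or, not_le, not_le] at hcon
    rcases hcon with h | h
    · simp only [hφ]
      rw [intervalIntegral.integral_congr (g := fun _ => 0), intervalIntegral.integral_zero]
      intro t ht
      refine image_eq_zero_of_notMem_tsupport fun htm => ?_
      have h1 := (hr htm).1
      rcases (mem_uIcc.mp ht) with h2 | h2 <;> linarith [h2.2]
    · simp only [hφ]
      rw [intervalIntegral.integral_eq_integral_of_support_subset, θi]
      intro t ht
      have h1 := hr (subset_tsupport _ ht)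
      constructor <;> linarith [h1.1, h1.2]
  have φc : HasCompactSupport φ :=
    HasCompactSupport.of_support_subset_isCompact isCompact_Icc ((subset_tsupport _).trans φt)
  have main := hk.integral_eq φ φs φc (φt.trans fun x hx => ⟨by linarith [hx.1], by linarith [hx.2]⟩)
  rw [φde] at main
  simp only [hθ, Pi.zero_apply, zero_mul, integral_zero, neg_zero, mul_sub] at main
  have i1 := integrableOn_mul_test hk.locInt ψs.continuous ψc ψt
  have i2 := integrableOn_mul_test hk.locInt ρs.continuous ρc ρt
  have e : ∀ x, k x * ((∫ y, ψ y) * ρ x) = (∫ y, ψ y) * (k x * ρ x) := fun x => by ring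
  simp only [e] at main
  rw [integral_sub i1 (i2.const_mul _), integral_const_mul, ← hC, setIntegral_mul_test _ ψt] at main
  have i3 : Integrable fun x => k x * ψ x := by
    refine (integrableOn_iff_integrable_of_support_subset fun x hx => ?_).mp i1
    exact ψt (subset_tsupport _ (right_ne_zero_of_mul hx))
  have e' : ∀ x, ψ x • (k x - C) = k x * ψ x - C * ψ x := fun x => by simp; ring
  simp only [e']
  rw [integral_sub i3 (ψi.const_mul _), integral_const_mul]
  linarith

/-! ### Point values -/

/-- Every neighbourhood of a point of `[-1, 1]`, endpoints included, meets `(-1, 1)` in positive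
measure. Hence point values are unique. -/
theorem eq_of_continuousWithinAt_of_ae_eq {F G : ℝ → ℝ} {x : ℝ} (hx : x ∈ Icc (-1 : ℝ) 1)
    (hFG : F =ᵐ[mu] G) (hF : ContinuousWithinAt F (Icc (-1) 1) x)
    (hG : ContinuousWithinAt G (Icc (-1) 1) x) : F x = G x := by
  by_contra hne
  have hev : ∀ᶠ y in 𝓝[Icc (-1) 1] x, F y - G y ≠ 0 :=
    (hF.sub hG).eventually_ne (sub_ne_zero.mpr hne)
  obtain ⟨U, hU, hxU, hsub⟩ := mem_nhdsWithin.mp hev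
  have hcl : x ∈ closure (Ioo (-1 : ℝ) 1) := by rwa [closure_Ioo (by norm_num)]
  obtain ⟨y, hy⟩ := mem_closure_iff.mp hcl U hU hxU
  have hpos : 0 < volume (U ∩ Ioo (-1 : ℝ) 1) := (hU.inter isOpen_Ioo).measure_pos _ ⟨y, hy⟩
  rw [EventuallyEq, ae_restrict_iff' measurableSet_Ioo] at hFG
  have : volume (U ∩ Ioo (-1 : ℝ) 1) = 0 := by
    refine measure_mono_null (fun z hz => ?_) hFG
    intro hz'
    exact hsub ⟨hz.1, Ioo_subset_Icc_self hz.2⟩ (sub_eq_zero.mpr (hz' hz.2))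
  exact hpos.ne' this

theorem HasPointValue.eq_of_ae_eq {f F : ℝ → ℝ} {x v : ℝ} (hx : x ∈ Icc (-1 : ℝ) 1)
    (h : HasPointValue f x v) (hf : f =ᵐ[mu] F) (hF : ContinuousWithinAt F (Icc (-1) 1) x) :
    F x = v := by
  obtain ⟨G, h1, h2, rfl⟩ := h
  exact eq_of_continuousWithinAt_of_ae_eq hx (hf.symm.trans h1) hF h2

/-! ### Hardy inequalities -/

theorem lintegral_Ioc_rpow {p x : ℝ} (hp : -1 < p) (hx : 0 < x) :
    ∫⁻ t in Ioc 0 x, ENNReal.ofReal (t ^ p) = ENNReal.ofReal (x ^ (p + 1) / (p + 1)) := by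
  have hi : IntegrableOn (fun t : ℝ => t ^ p) (Ioc 0 x) :=
    (intervalIntegrable_iff_integrableOn_Ioc_of_le hx.le).mp
      (intervalIntegral.intervalIntegrable_rpow' hp)
  rw [← ofReal_integral_eq_lintegral_ofReal hi, ← intervalIntegral.integral_of_le hx.le,
    integral_rpow (Or.inl hp), Real.zero_rpow (by linarith), sub_zero]
  filter_upwards [ae_restrict_mem measurableSet_Ioc] with t ht
  exact Real.rpow_nonneg ht.1.le _

theorem lintegral_Ioi_rpow {p x : ℝ} (hp : 0 < p) (hx : 0 < x) :
    ∫⁻ t in Ioi x, ENNReal.ofReal (t ^ (-1 - p)) = ENNReal.ofReal (x ^ (-p) / p) := by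
  rw [← ofReal_integral_eq_lintegral_ofReal (integrableOn_Ioi_rpow_of_lt (by linarith) hx),
    integral_Ioi_rpow_of_lt (by linarith) hx]
  · congr 1
    rw [show -1 - p + 1 = -p by ring, neg_div_neg_eq]
  · filter_upwards [ae_restrict_mem measurableSet_Ioi] with t ht
    exact Real.rpow_nonneg (hx.trans ht).le _

/-- Cauchy–Schwarz after splitting `t^s = t^((s - 1/2)/2) * t^((s + 1/2)/2)`. This split leads to
the constant `(s + 1/2)⁻²` in Hardy's inequality, which is `4` for `s = 0`. -/
theorem sq_lintegral_rpow_mul_le {s x : ℝ} (hs : -1 / 2 < s) (hx : 0 < x) {k : ℝ → ENNReal}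
    (hk : AEMeasurable k) :
    (∫⁻ t in Ioc 0 x, ENNReal.ofReal (t ^ s) * k t) ^ 2 ≤
      ENNReal.ofReal (x ^ (s + 1 / 2) / (s + 1 / 2)) *
        ∫⁻ t in Ioc 0 x, ENNReal.ofReal (t ^ (s + 1 / 2)) * k t ^ 2 := by
  have hm : ∀ p : ℝ, Measurable fun t : ℝ => ENNReal.ofReal (t ^ p) := fun p => by fun_prop
  have h1 := ENNReal.lintegral_mul_le_Lp_mul_Lq (volume.restrict (Ioc 0 x))
    Real.HolderConjugate.two_two (f := fun t => ENNReal.ofReal (t ^ ((s - 1 / 2) / 2)))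
    (g := fun t => ENNReal.ofReal (t ^ ((s + 1 / 2) / 2)) * k t)
    (hm _).aemeasurable ((hm _).aemeasurable.mul hk.restrict)
  have h2 : ∀ p t : ℝ, 0 < t →
      ENNReal.ofReal (t ^ (p / 2)) ^ (2 : ℝ) = ENNReal.ofReal (t ^ p) := by
    intro p t ht
    rw [ENNReal.ofReal_rpow_of_nonneg (Real.rpow_nonneg ht.le _) (by norm_num),
      ← Real.rpow_mul ht.le]
    congr 2; ring
  have e1 : ∫⁻ t in Ioc 0 x, ENNReal.ofReal (t ^ s) * k t =
      ∫⁻ t in Ioc 0 x, ((fun t => ENNReal.ofReal (t ^ ((s - 1 / 2) / 2))) *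
        fun t => ENNReal.ofReal (t ^ ((s + 1 / 2) / 2)) * k t) t := by
    refine setLIntegral_congr_fun measurableSet_Ioc fun t ht => ?_
    simp only [Pi.mul_apply]
    rw [← mul_assoc, ← ENNReal.ofReal_mul (Real.rpow_nonneg ht.1.le _), ← Real.rpow_add ht.1]
    congr 3; ring
  have e2 : ∫⁻ t in Ioc 0 x, ENNReal.ofReal (t ^ ((s - 1 / 2) / 2)) ^ (2 : ℝ) =
      ENNReal.ofReal (x ^ (s + 1 / 2) / (s + 1 / 2)) := by
    rw [setLIntegral_congr_fun measurableSet_Ioc fun t ht => h2 _ t ht.1,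
      lintegral_Ioc_rpow (by linarith) hx, show s - 1 / 2 + 1 = s + 1 / 2 by ring]
  have e3 : ∫⁻ t in Ioc 0 x, (ENNReal.ofReal (t ^ ((s + 1 / 2) / 2)) * k t) ^ (2 : ℝ) =
      ∫⁻ t in Ioc 0 x, ENNReal.ofReal (t ^ (s + 1 / 2)) * k t ^ 2 := by
    refine setLIntegral_congr_fun measurableSet_Ioc fun t ht => ?_
    rw [ENNReal.mul_rpow_of_nonneg _ _ (by norm_num), h2 _ t ht.1, ENNReal.rpow_two]
  rw [e2, e3, ← e1, ← ENNReal.mul_rpow_of_nonneg _ _ (by norm_num)] at h1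
  calc _ ≤ _ := pow_le_pow_left' h1 2
    _ = _ := by
      rw [← ENNReal.rpow_two, ← ENNReal.rpow_mul]
      norm_num

/-- Tonelli: `∫ x^(-1-p)` over `x > t` is `t^(-p) / p`, which cancels the weight `t^p`. -/
theorem lintegral_rpow_mul_lintegral_Ioc {p : ℝ} (hp : 0 < p) {k : ℝ → ENNReal}
    (hk : AEMeasurable k) :
    ∫⁻ x in Ioi (0 : ℝ), ENNReal.ofReal (x ^ (-1 - p)) *
        ∫⁻ t in Ioc 0 x, ENNReal.ofReal (t ^ p) * k t =
      ENNReal.ofReal p⁻¹ * ∫⁻ t in Ioi (0 : ℝ), k t := by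
  have hm : ∀ p : ℝ, Measurable fun t : ℝ => ENNReal.ofReal (t ^ p) := fun p => by fun_prop
  set K : ℝ × ℝ → ENNReal := {z : ℝ × ℝ | z.2 ≤ z.1}.indicator fun z =>
    ENNReal.ofReal (z.1 ^ (-1 - p)) * (ENNReal.ofReal (z.2 ^ p) * k z.2) with hK
  have hKm : AEMeasurable K ((volume.restrict (Ioi (0 : ℝ))).prod (volume.restrict (Ioi 0))) := by
    refine AEMeasurable.indicator ?_ (measurableSet_le measurable_snd measurable_fst)
    exact ((hm _).comp measurable_fst).aemeasurable.mul
      (((hm _).comp measurable_snd).aemeasurable.mul hk.restrict.comp_snd)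
  have e1 : ∀ x ∈ Ioi (0 : ℝ), ENNReal.ofReal (x ^ (-1 - p)) *
      ∫⁻ t in Ioc 0 x, ENNReal.ofReal (t ^ p) * k t = ∫⁻ t in Ioi 0, K (x, t) := by
    intro x hx
    have : (fun t => K (x, t)) = (Iic x).indicator fun t => ENNReal.ofReal (x ^ (-1 - p)) *
        (ENNReal.ofReal (t ^ p) * k t) := by
      ext t; simp [hK, indicator_apply]
    rw [this, lintegral_indicator measurableSet_Iic, Measure.restrict_restrict measurableSet_Iic,
      inter_comm, Ioi_inter_Iic, lintegral_const_mul' _ _ ENNReal.ofReal_ne_top]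
  have e2 : ∀ t ∈ Ioi (0 : ℝ), ∫⁻ x in Ioi 0, K (x, t) = ENNReal.ofReal p⁻¹ * k t := by
    intro t ht
    have : (fun x => K (x, t)) = (Ici t).indicator fun x => ENNReal.ofReal (x ^ (-1 - p)) *
        (ENNReal.ofReal (t ^ p) * k t) := by
      ext t; simp [hK, indicator_apply]
    rw [this, lintegral_indicator measurableSet_Ici, Measure.restrict_restrict measurableSet_Ici,
      inter_eq_self_of_subset_left (Ici_subset_Ioi.mpr ht), lintegral_mul_const _ (hm _),
      setLIntegral_congr Ioi_ae_eq_Ici.symm, lintegral_Ioi_rpow hp ht, ← mul_assoc,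
      ← ENNReal.ofReal_mul (div_nonneg (Real.rpow_nonneg (mem_Ioi.mp ht).le _) hp.le),
      div_mul_eq_mul_div, ← Real.rpow_add ht]
    simp
  rw [setLIntegral_congr_fun measurableSet_Ioi e1, lintegral_lintegral_swap (f := fun x t => K (x, t)) hKm,
    setLIntegral_congr_fun measurableSet_Ioi e2, lintegral_const_mul' _ _ ENNReal.ofReal_ne_top]

theorem enorm_intervalIntegral_rpow_mul_le {s x : ℝ} (hx : 0 < x) (h : ℝ → ℝ) :
    ‖∫ t in (0 : ℝ)..x, t ^ s * h t‖ₑ ≤ ∫⁻ t in Ioc 0 x, ENNReal.ofReal (t ^ s) * ‖h t‖ₑ := by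
  rw [intervalIntegral.integral_of_le hx.le]
  refine (enorm_integral_le_lintegral_enorm _).trans_eq ?_
  refine setLIntegral_congr_fun measurableSet_Ioc fun t ht => ?_
  rw [enorm_mul, Real.enorm_of_nonneg (Real.rpow_nonneg ht.1.le _)]

/-- The weighted Hardy inequality. -/
theorem lintegral_hardy_le {s : ℝ} (hs : -1 / 2 < s) {h : ℝ → ℝ} (hh : AEMeasurable h) :
    ∫⁻ x in Ioi (0 : ℝ), ‖x ^ (-1 - s) * ∫ t in (0 : ℝ)..x, t ^ s * h t‖ₑ ^ 2 ≤
      ENNReal.ofReal ((s + 1 / 2)⁻¹ ^ 2) * ∫⁻ t in Ioi (0 : ℝ), ‖h t‖ₑ ^ 2 := by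
  have hσ : 0 < s + 1 / 2 := by linarith
  -- With `σ = s + 1/2`, the powers of `x` combine as `2(-1 - s) + σ = -1 - σ`, the weight required
  -- by the Tonelli step.
  have hb : ∀ x ∈ Ioi (0 : ℝ), ‖x ^ (-1 - s) * ∫ t in (0 : ℝ)..x, t ^ s * h t‖ₑ ^ 2 ≤
      ENNReal.ofReal (s + 1 / 2)⁻¹ * (ENNReal.ofReal (x ^ (-1 - (s + 1 / 2))) *
        ∫⁻ t in Ioc 0 x, ENNReal.ofReal (t ^ (s + 1 / 2)) * ‖h t‖ₑ ^ 2) := by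
    intro x hx
    have hx0 : 0 < x := hx
    rw [enorm_mul, mul_pow, Real.enorm_of_nonneg (Real.rpow_nonneg hx0.le _)]
    refine (mul_le_mul_right ((pow_le_pow_left' (enorm_intervalIntegral_rpow_mul_le hx0 h) 2).trans
      (sq_lintegral_rpow_mul_le hs hx0 hh.enorm)) _).trans_eq ?_
    rw [← mul_assoc, ← mul_assoc, ← ENNReal.ofReal_pow (Real.rpow_nonneg hx0.le _),
      ← ENNReal.ofReal_mul (pow_nonneg (Real.rpow_nonneg hx0.le _) 2),
      ← ENNReal.ofReal_mul (inv_nonneg.mpr hσ.le)]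
    congr 2
    rw [← Real.rpow_natCast, ← Real.rpow_mul hx0.le, mul_div_assoc', ← Real.rpow_add hx0,
      div_eq_inv_mul]
    congr 2
    push_cast; ring
  refine (setLIntegral_mono' measurableSet_Ioi hb).trans_eq ?_
  rw [lintegral_const_mul' _ _ ENNReal.ofReal_ne_top,
    lintegral_rpow_mul_lintegral_Ioc hσ (hh.enorm.pow_const 2), ← mul_assoc,
    ← ENNReal.ofReal_mul (inv_nonneg.mpr hσ.le), sq]

/-! ### Square integrability and pointwise bounds from Hardy's inequality -/

theorem memLp_two_iff_lintegral_lt_top {μ : Measure ℝ} {f : ℝ → ℝ} (hf : AEStronglyMeasurable f μ) :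
    MemLp f 2 μ ↔ ∫⁻ x, ‖f x‖ₑ ^ 2 ∂μ < ⊤ := by
  rw [MemLp, and_iff_right hf, eLpNorm_lt_top_iff_lintegral_rpow_enorm_lt_top (by simp) (by simp)]
  simp

theorem locallyIntegrable_of_memLp {h : ℝ → ℝ} (hh : MemLp h 2) : LocallyIntegrable h :=
  hh.locallyIntegrable (by norm_num)

theorem memLp_rpow {s : ℝ} (hs : -1 / 2 < s) (x : ℝ) :
    MemLp (fun t : ℝ => t ^ s) 2 (volume.restrict (Ioc 0 x)) := by
  rcases le_or_gt x 0 with hx | hx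
  · simp [Ioc_eq_empty_of_le hx]
  have hm : Measurable fun t : ℝ => t ^ s := by fun_prop
  rw [memLp_two_iff_lintegral_lt_top hm.aestronglyMeasurable]
  have : ∀ t ∈ Ioc 0 x, ‖t ^ s‖ₑ ^ 2 = ENNReal.ofReal (t ^ (2 * s)) := by
    intro t ht
    rw [Real.enorm_of_nonneg (Real.rpow_nonneg ht.1.le _),
      ← ENNReal.ofReal_pow (Real.rpow_nonneg ht.1.le _), ← Real.rpow_natCast,
      ← Real.rpow_mul ht.1.le]
    congr 2; push_cast; ring
  rw [setLIntegral_congr_fun measurableSet_Ioc this, lintegral_Ioc_rpow (by linarith) hx]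
  exact ENNReal.ofReal_lt_top

theorem integrableOn_rpow_mul {s : ℝ} (hs : -1 / 2 < s) {x : ℝ} {h : ℝ → ℝ}
    (hh : MemLp h 2 (volume.restrict (Ioc 0 x))) : IntegrableOn (fun t => t ^ s * h t) (Ioc 0 x) :=
  (memLp_rpow hs x).integrable_mul hh

theorem memLp_hardy {s : ℝ} (hs : -1 / 2 < s) {h : ℝ → ℝ} (hh : MemLp h 2) :
    MemLp (fun x => x ^ (-1 - s) * ∫ t in (0 : ℝ)..x, t ^ s * h t) 2
      (volume.restrict (Ioi 0)) := by
  have hm : Measurable fun t : ℝ => t ^ (-1 - s) := by fun_prop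
  have hc : ContinuousOn (fun x => ∫ t in (0 : ℝ)..x, t ^ s * h t) (Ioi 0) := by
    intro x hx
    have hx0 : (0 : ℝ) < x := hx
    have hi : IntegrableOn (fun t => t ^ s * h t) (uIcc 0 (x + 1)) := by
      rw [uIcc_of_le (by linarith), integrableOn_Icc_iff_integrableOn_Ioc]
      exact integrableOn_rpow_mul hs (hh.restrict _)
    have := intervalIntegral.continuousOn_primitive_interval hi
    rw [uIcc_of_le (by linarith)] at this
    exact (this.continuousAt (Icc_mem_nhds hx0 (by linarith))).continuousWithinAt
  refine (memLp_two_iff_lintegral_lt_top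
    (hm.aestronglyMeasurable.mul (hc.aestronglyMeasurable measurableSet_Ioi))).mpr ?_
  refine (lintegral_hardy_le hs hh.aestronglyMeasurable.aemeasurable).trans_lt ?_
  refine ENNReal.mul_lt_top ENNReal.ofReal_lt_top ?_
  exact (memLp_two_iff_lintegral_lt_top hh.aestronglyMeasurable.restrict).mp (hh.restrict _)

/-- The same Cauchy–Schwarz estimate with the remaining weight bounded by its value at `x`. These
bounds make all boundary terms at `0` vanish. -/
theorem exists_abs_intervalIntegral_rpow_mul_le {s : ℝ} (hs : -1 / 2 < s) {h : ℝ → ℝ}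
    (hh : MemLp h 2) :
    ∃ C : ℝ, ∀ x : ℝ, 0 < x → |∫ t in (0 : ℝ)..x, t ^ s * h t| ≤ C * x ^ (s + 1 / 2) := by
  have hσ : 0 < s + 1 / 2 := by linarith
  have hfin := ((memLp_two_iff_lintegral_lt_top hh.aestronglyMeasurable).mp hh)
  set I := ∫⁻ t, ‖h t‖ₑ ^ 2 with hI
  refine ⟨√(I.toReal / (s + 1 / 2)), fun x hx => ?_⟩
  have h1 : ‖∫ t in (0 : ℝ)..x, t ^ s * h t‖ₑ ^ 2 ≤
      ENNReal.ofReal (x ^ (s + 1 / 2) / (s + 1 / 2)) * (ENNReal.ofReal (x ^ (s + 1 / 2)) * I) := by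
    refine ((pow_le_pow_left' (enorm_intervalIntegral_rpow_mul_le hx h) 2).trans
      (sq_lintegral_rpow_mul_le hs hx hh.aestronglyMeasurable.aemeasurable.enorm)).trans ?_
    gcongr
    rw [hI, ← lintegral_const_mul' _ _ ENNReal.ofReal_ne_top]
    refine (setLIntegral_mono' measurableSet_Ioc fun t ht => ?_).trans
      (setLIntegral_le_lintegral _ _)
    gcongr
    exacts [ht.1.le, ht.2]
  rw [← ENNReal.ofReal_toReal hfin.ne, ← ENNReal.ofReal_mul (by positivity),
    ← ENNReal.ofReal_mul (by positivity), Real.enorm_eq_ofReal_abs,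
    ← ENNReal.ofReal_pow (abs_nonneg _), ENNReal.ofReal_le_ofReal_iff (by positivity)] at h1
  refine abs_le_of_sq_le_sq' ?_ (by positivity) |>.2
  rw [mul_pow, Real.sq_sqrt (by positivity)]
  refine h1.trans_eq ?_
  field_simp

/-! ### Calculus on `(0, 1)` -/

theorem tendsto_zero_of_abs_le_rpow {F : ℝ → ℝ} {C p : ℝ} (hp : 0 < p)
    (hF : ∀ x, 0 < x → |F x| ≤ C * x ^ p) : Tendsto F (𝓝[>] 0) (𝓝 0) := by
  have h1 : Tendsto (fun x : ℝ => C * x ^ p) (𝓝[>] 0) (𝓝 0) := by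
    have := ((Real.continuous_rpow_const hp.le).const_mul C).tendsto 0
    rw [Real.zero_rpow hp.ne', mul_zero] at this
    exact this.mono_left nhdsWithin_le_nhds
  refine squeeze_zero_norm' ?_ h1
  filter_upwards [self_mem_nhdsWithin] with x hx
  exact hF x hx

/-- The fundamental theorem of calculus on `[ε, x]`, followed by `ε → 0`. Absolute continuity up to
`0` is not assumed, because the functions used contain powers that may be singular there. -/
theorem intervalIntegral_eq_of_tendsto_zero {F f : ℝ → ℝ} {x : ℝ} (hx : 0 < x)
    (hf : IntegrableOn f (Ioc 0 x))
    (hF : ∀ ε, 0 < ε → AbsolutelyContinuousOnInterval F ε x)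
    (hd : ∀ᵐ t, 0 < t → HasDerivAt F (f t) t) (h0 : Tendsto F (𝓝[>] 0) (𝓝 0)) :
    ∫ t in (0 : ℝ)..x, f t = F x := by
  have hi : IntegrableOn f (uIcc 0 x) := by
    rwa [uIcc_of_le hx.le, integrableOn_Icc_iff_integrableOn_Ioc]
  have hc : Tendsto (fun ε => ∫ t in (0 : ℝ)..ε, f t) (𝓝[>] 0) (𝓝 0) := by
    have h1 := intervalIntegral.continuousOn_primitive_interval hi 0 left_mem_uIcc
    have h2 : 𝓝[>] (0 : ℝ) ≤ 𝓝[uIcc 0 x] 0 := by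
      rw [uIcc_of_le hx.le, ← nhdsWithin_Ioc_eq_nhdsGT hx]
      exact nhdsWithin_mono _ Ioc_subset_Icc_self
    simpa [ContinuousWithinAt] using h1.tendsto.mono_left h2
  have h3 : Tendsto (fun ε => F ε + ∫ t in ε..x, f t) (𝓝[>] 0) (𝓝 (∫ t in (0 : ℝ)..x, f t)) := by
    have h4 := h0.add ((tendsto_const_nhds (x := ∫ t in (0 : ℝ)..x, f t)).sub hc)
    rw [sub_zero, zero_add] at h4
    refine h4.congr' ?_
    filter_upwards [Ioc_mem_nhdsGT hx] with ε hε
    rw [intervalIntegral.integral_interval_sub_left]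
    · exact (intervalIntegrable_iff_integrableOn_Ioc_of_le hx.le).mpr hf
    · exact (intervalIntegrable_iff_integrableOn_Ioc_of_le hε.1.le).mpr
        (hf.mono_set (Ioc_subset_Ioc_right hε.2))
  refine tendsto_nhds_unique h3 (tendsto_const_nhds.congr' ?_)
  filter_upwards [Ioc_mem_nhdsGT hx] with ε hε
  rw [integral_eq_sub_of_ae_hasDerivAt (hF ε hε.1)]
  · ring
  · filter_upwards [hd] with t ht hmem
    rw [uIcc_of_le hε.2] at hmem
    exact ht (hε.1.trans_le hmem.1)

theorem absolutelyContinuousOnInterval_rpow {ε x : ℝ} (hε : 0 < ε) (hx : 0 < x) (p : ℝ) :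
    AbsolutelyContinuousOnInterval (fun t : ℝ => t ^ p) ε x := by
  refine ContDiffOn.absolutelyContinuousOnInterval (fun t ht => ?_)
  have : 0 < t := (lt_min hε hx).trans_le ht.1
  exact (Real.contDiffAt_rpow_const_of_ne this.ne').contDiffWithinAt

/-! ### Behaviour of regular parts at the origin -/

theorem exists_abs_prim_le {h : ℝ → ℝ} (hh : MemLp h 2) :
    ∃ C : ℝ, 0 ≤ C ∧ ∀ x : ℝ, 0 < x → |prim h x| ≤ C * x ^ (1 / 2 : ℝ) := by
  obtain ⟨C, hC⟩ := exists_abs_intervalIntegral_rpow_mul_le (s := 0) (by norm_num) hh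
  simp only [Real.rpow_zero, one_mul, zero_add] at hC
  refine ⟨C, ?_, hC⟩
  have := hC 1 one_pos
  rw [Real.one_rpow, mul_one] at this
  exact (abs_nonneg _).trans this

theorem exists_abs_prim_prim_le {h : ℝ → ℝ} (hh : MemLp h 2) :
    ∃ C : ℝ, ∀ x : ℝ, 0 < x → |prim (prim h) x| ≤ C * x ^ (3 / 2 : ℝ) := by
  obtain ⟨C, hC0, hC⟩ := exists_abs_prim_le hh
  refine ⟨C, fun x hx => ?_⟩
  have := intervalIntegral.norm_integral_le_of_norm_le_const (a := 0) (b := x) (f := prim h)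
    (C := C * x ^ (1 / 2 : ℝ)) (fun t ht => ?_)
  · rw [sub_zero, abs_of_pos hx, mul_assoc] at this
    refine this.trans_eq ?_
    congr 1
    nth_rewrite 2 [← Real.rpow_one x]
    rw [← Real.rpow_add hx]
    norm_num
  · rw [uIoc_of_le hx.le] at ht
    refine (hC t ht.1).trans ?_
    gcongr
    exacts [ht.1.le, ht.2]

theorem memLp_prim_div {h : ℝ → ℝ} (hh : MemLp h 2) :
    MemLp (fun x => prim h x / x) 2 (volume.restrict (Ioi 0)) := by
  refine (memLp_congr_ae ?_).mp (memLp_hardy (s := 0) (by norm_num) hh)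
  filter_upwards with x
  simp only [Real.rpow_zero, one_mul, sub_zero, Real.rpow_neg_one, prim]
  ring

/-- Hardy twice: with `R = prim (prim h)`, the case `s = 0` gives `R' / x ∈ L²`, and `R / x² = x⁻² ∫
t (R' / t)` is then the case `s = 1`. -/
theorem memLp_prim_prim_div_sq {h : ℝ → ℝ} (hh : MemLp h 2) :
    MemLp (fun x => prim (prim h) x / x ^ 2) 2 (volume.restrict (Ioi 0)) := by
  have hk : MemLp ((Ioi 0).indicator fun x => prim h x / x) 2 :=
    (memLp_indicator_iff_restrict measurableSet_Ioi).mpr (memLp_prim_div hh)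
  refine (memLp_congr_ae ?_).mp (memLp_hardy (s := 1) (by norm_num) hk)
  filter_upwards [ae_restrict_mem measurableSet_Ioi] with x hx
  have hx0 : 0 < x := hx
  have e : ∫ t in (0 : ℝ)..x, t ^ (1 : ℝ) * (Ioi 0).indicator (fun x => prim h x / x) t =
      prim (prim h) x := by
    refine intervalIntegral.integral_congr_ae (Eventually.of_forall fun t ht => ?_)
    rw [uIoc_of_le hx0.le] at ht
    rw [indicator_of_mem (mem_Ioi.mpr ht.1), Real.rpow_one, mul_div_cancel₀ _ ht.1.ne']
  rw [e, show (-1 - 1 : ℝ) = -(2 : ℕ) by norm_num, Real.rpow_neg hx0.le, Real.rpow_natCast]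
  ring

/-- The power `x^s` is annihilated by `-∂² + s (s - 1) / x²`, so the integrand is the derivative of
the Wronskian `-R' x^s + s R x^(s-1)`, where `R = prim (prim h)`. Since `R' = O(x^(1/2))`, `R =
O(x^(3/2))` and `s > -1/2`, it tends to `0` at the origin. -/
theorem integral_expr_mul_rpow {s : ℝ} (hs : -1 / 2 < s) {h : ℝ → ℝ} (hh : MemLp h 2) :
    ∫ x in (0 : ℝ)..1, (-h x + s * (s - 1) / x ^ 2 * prim (prim h) x) * x ^ s =
      -prim h 1 + s * prim (prim h) 1 := by
  have hl := locallyIntegrable_of_memLp hh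
  have hG := continuous_prim hl
  obtain ⟨C₁, _, hC₁⟩ := exists_abs_prim_le hh
  obtain ⟨C₂, hC₂⟩ := exists_abs_prim_prim_le hh
  have hint : IntegrableOn (fun x => (-h x + s * (s - 1) / x ^ 2 * prim (prim h) x) * x ^ s)
      (Ioc 0 1) := by
    have h1 : MemLp (fun x => -h x + s * (s - 1) * (prim (prim h) x / x ^ 2)) 2
        (volume.restrict (Ioc 0 1)) :=
      (hh.restrict _).neg.add
        (((memLp_prim_prim_div_sq hh).mono_measure (Measure.restrict_mono
          Ioc_subset_Ioi_self le_rfl)).const_mul _)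
    refine (integrableOn_rpow_mul hs h1).congr (Eventually.of_forall fun x => ?_)
    simp only
    ring
  have hF := intervalIntegral_eq_of_tendsto_zero
    (F := fun x => -(prim h x * x ^ s) + s * (prim (prim h) x * x ^ (s - 1))) one_pos hint
    (fun ε hε => ?_) ?_ ?_
  · rw [hF]; simp
  · exact ((absolutelyContinuousOnInterval_prim hl ε 1).fun_mul
      (absolutelyContinuousOnInterval_rpow hε one_pos s)).fun_neg.fun_add
      (((absolutelyContinuousOnInterval_prim hG.locallyIntegrable ε 1).fun_mul
      (absolutelyContinuousOnInterval_rpow hε one_pos (s - 1))).const_mul s)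
  · filter_upwards [ae_hasDerivAt_prim hl] with t ht ht0
    have d1 := (Real.hasDerivAt_rpow_const (p := s) (Or.inl ht0.ne'))
    have d2 := (Real.hasDerivAt_rpow_const (p := s - 1) (Or.inl ht0.ne'))
    have d3 := hasDerivAt_prim hG t
    refine ((ht.mul d1).neg.add ((d3.mul d2).const_mul s)).congr_deriv ?_
    rw [show s - 1 - 1 = s - (2 : ℕ) by push_cast; ring, Real.rpow_sub_natCast ht0.ne']
    ring
  · have t1 : Tendsto (fun x => prim h x * x ^ s) (𝓝[>] 0) (𝓝 0) := by
      refine tendsto_zero_of_abs_le_rpow (C := C₁) (p := 1 / 2 + s) (by linarith) fun x hx => ?_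
      rw [abs_mul, abs_of_pos (Real.rpow_pos_of_pos hx s), Real.rpow_add hx, ← mul_assoc]
      gcongr
      exact hC₁ x hx
    have t2 : Tendsto (fun x => prim (prim h) x * x ^ (s - 1)) (𝓝[>] 0) (𝓝 0) := by
      refine tendsto_zero_of_abs_le_rpow (C := C₂) (p := 3 / 2 + (s - 1)) (by linarith)
        fun x hx => ?_
      rw [abs_mul, abs_of_pos (Real.rpow_pos_of_pos hx _), Real.rpow_add hx, ← mul_assoc]
      gcongr
      exact hC₂ x hx
    simpa using t1.neg.add (t2.const_mul s)

theorem integral_mul_prim_prim {h k : ℝ → ℝ} (hh : MemLp h 2) (hk : MemLp k 2) :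
    ∫ x in (0 : ℝ)..1, h x * prim (prim k) x =
      prim h 1 * prim (prim k) 1 - ∫ x in (0 : ℝ)..1, prim h x * prim k x := by
  have hl := locallyIntegrable_of_memLp hh
  have hG := continuous_prim (locallyIntegrable_of_memLp hk)
  have := (absolutelyContinuousOnInterval_prim hG.locallyIntegrable 0
    1).integral_mul_deriv_eq_deriv_mul (absolutelyContinuousOnInterval_prim hl 0 1)
  rw [prim_zero, zero_mul, sub_zero] at this
  have e1 : ∫ x in (0 : ℝ)..1, h x * prim (prim k) x =
      ∫ x in (0 : ℝ)..1, prim (prim k) x * deriv (prim h) x := by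
    refine intervalIntegral.integral_congr_ae ?_
    filter_upwards [ae_hasDerivAt_prim hl] with x hx _
    rw [hx.deriv, mul_comm]
  have e2 : ∫ x in (0 : ℝ)..1, deriv (prim (prim k)) x * prim h x =
      ∫ x in (0 : ℝ)..1, prim h x * prim k x := by
    refine intervalIntegral.integral_congr fun x _ => ?_
    rw [(hasDerivAt_prim hG x).deriv, mul_comm]
  rw [e1, this, e2]
  ring

/-- The quadratic form of `-∂² + c / x²` on the regular parts, on `(0, 1)`. -/
def halfForm (c : ℝ) (h k : ℝ → ℝ) : ℝ :=
  ∫ x in (0 : ℝ)..1, prim h x * prim k x + c / x ^ 2 * (prim (prim h) x * prim (prim k) x)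

theorem halfForm_comm (c : ℝ) (h k : ℝ → ℝ) : halfForm c h k = halfForm c k h := by
  unfold halfForm
  refine intervalIntegral.integral_congr fun x _ => ?_
  ring

theorem intervalIntegrable_prim_mul {h k : ℝ → ℝ} (hh : MemLp h 2) (hk : MemLp k 2) :
    IntervalIntegrable (fun x => prim h x * prim k x) volume 0 1 :=
  ((continuous_prim (locallyIntegrable_of_memLp hh)).mul
    (continuous_prim (locallyIntegrable_of_memLp hk))).intervalIntegrable _ _

theorem memLp_prim_prim_div_sq_Ioc (c : ℝ) {h : ℝ → ℝ} (hh : MemLp h 2) :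
    MemLp (fun x => c / x ^ 2 * prim (prim h) x) 2 (volume.restrict (Ioc 0 1)) := by
  refine (memLp_congr_ae (Eventually.of_forall fun x => ?_)).mp
    (((memLp_prim_prim_div_sq hh).mono_measure (Measure.restrict_mono
          Ioc_subset_Ioi_self le_rfl)).const_mul c)
  ring

theorem continuous_prim_prim {h : ℝ → ℝ} (hh : MemLp h 2) : Continuous (prim (prim h)) :=
  continuous_prim (continuous_prim (locallyIntegrable_of_memLp hh)).locallyIntegrable

theorem memLp_of_continuous {f : ℝ → ℝ} (hf : Continuous f) (a b : ℝ) :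
    MemLp f 2 (volume.restrict (Ioc a b)) := by
  obtain ⟨C, hC⟩ := isCompact_Icc.exists_bound_of_continuousOn (s := Icc a b) hf.continuousOn
  refine MemLp.of_bound hf.aestronglyMeasurable C ?_
  filter_upwards [ae_restrict_mem measurableSet_Ioc] with x hx
  exact hC x (Ioc_subset_Icc_self hx)

theorem intervalIntegrable_prim_prim_mul (c : ℝ) {h k : ℝ → ℝ} (hh : MemLp h 2) (hk : MemLp k 2) :
    IntervalIntegrable (fun x => c / x ^ 2 * (prim (prim h) x * prim (prim k) x)) volume 0 1 := by
  rw [intervalIntegrable_iff_integrableOn_Ioc_of_le zero_le_one]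
  refine ((memLp_prim_prim_div_sq_Ioc c hh).integrable_mul
    (memLp_of_continuous (continuous_prim_prim hk) 0 1)).congr (Eventually.of_forall fun x => ?_)
  simp only [Pi.mul_apply]
  ring

theorem halfForm_eq {c : ℝ} {h k : ℝ → ℝ} (hh : MemLp h 2) (hk : MemLp k 2) :
    halfForm c h k = (∫ x in (0 : ℝ)..1, prim h x * prim k x) +
      ∫ x in (0 : ℝ)..1, c / x ^ 2 * (prim (prim h) x * prim (prim k) x) :=
  intervalIntegral.integral_add (intervalIntegrable_prim_mul hh hk)
    (intervalIntegrable_prim_prim_mul c hh hk)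

/-- Green's formula on `(0, 1)`; the boundary terms at `0` vanish. -/
theorem integral_expr_mul {ν : ℝ} (hν : ν ∈ Ioo (0 : ℝ) 1) {h k : ℝ → ℝ}
    (hh : MemLp h 2) (hk : MemLp k 2) (c₁ c₂ : ℝ)
    (hbd : prim (prim k) 1 + (c₁ + c₂) = 0) :
    ∫ x in (0 : ℝ)..1, (-h x + (ν ^ 2 - 1 / 4) / x ^ 2 * prim (prim h) x) *
        (prim (prim k) x + (c₁ * x ^ (ν + 1 / 2) + c₂ * x ^ (-ν + 1 / 2))) =
      halfForm (ν ^ 2 - 1 / 4) h k +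
        prim (prim h) 1 * ((ν + 1 / 2) * c₁ + (-ν + 1 / 2) * c₂) := by
  obtain ⟨hν0, hν1⟩ := hν
  set c := ν ^ 2 - 1 / 4 with hc
  have hu : MemLp (fun x => -h x + c / x ^ 2 * prim (prim h) x) 2 (volume.restrict (Ioc 0 1)) :=
    (hh.restrict _).neg.add (memLp_prim_prim_div_sq_Ioc c hh)
  have hK := memLp_of_continuous (continuous_prim_prim hk) 0 1
  have i1 : IntervalIntegrable (fun x => (-h x + c / x ^ 2 * prim (prim h) x) * prim (prim k) x)
      volume 0 1 := by
    rw [intervalIntegrable_iff_integrableOn_Ioc_of_le zero_le_one]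
    exact hu.integrable_mul hK
  have i2 : ∀ s : ℝ, -1 / 2 < s → IntervalIntegrable
      (fun x => (-h x + c / x ^ 2 * prim (prim h) x) * x ^ s) volume 0 1 := by
    intro s hs
    rw [intervalIntegrable_iff_integrableOn_Ioc_of_le zero_le_one]
    exact hu.integrable_mul (memLp_rpow hs 1)
  have i3 : IntervalIntegrable (fun x => h x * prim (prim k) x) volume 0 1 := by
    rw [intervalIntegrable_iff_integrableOn_Ioc_of_le zero_le_one]
    exact (hh.restrict _).integrable_mul hK
  have ea := integral_expr_mul_rpow (s := ν + 1 / 2) (by linarith) hh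
  have eb := integral_expr_mul_rpow (s := -ν + 1 / 2) (by linarith) hh
  rw [show (ν + 1 / 2) * (ν + 1 / 2 - 1) = c by rw [hc]; ring] at ea
  rw [show (-ν + 1 / 2) * (-ν + 1 / 2 - 1) = c by rw [hc]; ring] at eb
  have e1 : ∫ x in (0 : ℝ)..1, (-h x + c / x ^ 2 * prim (prim h) x) * prim (prim k) x =
      -(prim h 1 * prim (prim k) 1) + halfForm c h k := by
    rw [halfForm_eq hh hk]
    have : ∀ x, (-h x + c / x ^ 2 * prim (prim h) x) * prim (prim k) x =
      c / x ^ 2 * (prim (prim h) x * prim (prim k) x) - h x * prim (prim k) x := fun x => by ring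
    simp only [this]
    rw [intervalIntegral.integral_sub (intervalIntegrable_prim_prim_mul c hh hk) i3,
      integral_mul_prim_prim hh hk]
    ring
  have e2 : ∀ x, (-h x + c / x ^ 2 * prim (prim h) x) *
        (prim (prim k) x + (c₁ * x ^ (ν + 1 / 2) + c₂ * x ^ (-ν + 1 / 2))) =
      (-h x + c / x ^ 2 * prim (prim h) x) * prim (prim k) x +
      (c₁ * ((-h x + c / x ^ 2 * prim (prim h) x) * x ^ (ν + 1 / 2)) +
      c₂ * ((-h x + c / x ^ 2 * prim (prim h) x) * x ^ (-ν + 1 / 2))) := fun x => by ring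
  simp only [e2]
  rw [intervalIntegral.integral_add i1 (((i2 _ (by linarith)).const_mul _).add
      ((i2 _ (by linarith)).const_mul _)),
    intervalIntegral.integral_add ((i2 _ (by linarith)).const_mul _)
      ((i2 _ (by linarith)).const_mul _),
    intervalIntegral.integral_const_mul, intervalIntegral.integral_const_mul, ea, eb, e1]
  -- The factor of `prim h 1` is the value at `1` of the function tested against, which is zero.
  linear_combination (-prim h 1) * hbd

/-- Hardy's inequality bounds the form from below. -/
theorem min_mul_le_halfForm {ν : ℝ} {h : ℝ → ℝ} (hh : MemLp h 2) :
    min 1 (4 * ν ^ 2) * ∫ x in (0 : ℝ)..1, prim h x ^ 2 ≤ halfForm (ν ^ 2 - 1 / 4) h h := by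
  have hGc := continuous_prim (locallyIntegrable_of_memLp hh)
  set I := ∫ x in (0 : ℝ)..1, prim h x ^ 2 with hI
  set J := ∫ x in (0 : ℝ)..1, (prim (prim h) x / x) ^ 2 with hJ
  have hI0 : 0 ≤ I := intervalIntegral.integral_nonneg zero_le_one fun x _ => sq_nonneg _
  have hJ0 : 0 ≤ J := intervalIntegral.integral_nonneg zero_le_one fun x _ => sq_nonneg _
  have hform : halfForm (ν ^ 2 - 1 / 4) h h = I + (ν ^ 2 - 1 / 4) * J := by
    rw [halfForm_eq hh hh, hI, hJ, ← intervalIntegral.integral_const_mul]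
    congr 1 <;> refine intervalIntegral.integral_congr fun x _ => ?_
    · ring
    · ring
  -- Hardy with `s = 0`, whose constant is `(1/2)⁻² = 4`, applied to `prim h` cut off outside `(0,
  -- 1]` so that it lies in `L²` of the line.
  have hJI : J ≤ 4 * I := by
    set g : ℝ → ℝ := (Ioc 0 1).indicator (prim h) with hg
    have hgL : MemLp g 2 :=
      (memLp_indicator_iff_restrict measurableSet_Ioc).mpr (memLp_of_continuous hGc 0 1)
    have hardy := lintegral_hardy_le (s := 0) (by norm_num) hgL.aestronglyMeasurable.aemeasurable
    have r1 : ∫⁻ t in Ioi (0 : ℝ), ‖g t‖ₑ ^ 2 = ENNReal.ofReal I := by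
      have : (fun t => ‖g t‖ₑ ^ 2) = (Ioc 0 1).indicator fun t => ENNReal.ofReal (prim h t ^ 2) := by
        ext t
        by_cases ht : t ∈ Ioc (0 : ℝ) 1
        · rw [hg, indicator_of_mem ht, indicator_of_mem ht, Real.enorm_eq_ofReal_abs,
            ← ENNReal.ofReal_pow (abs_nonneg _), sq_abs]
        · rw [hg, indicator_of_notMem ht, indicator_of_notMem ht]; simp
      rw [this, lintegral_indicator measurableSet_Ioc, Measure.restrict_restrict measurableSet_Ioc,
        inter_eq_self_of_subset_left Ioc_subset_Ioi_self, hI,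
        intervalIntegral.integral_of_le zero_le_one, ofReal_integral_eq_lintegral_ofReal]
      · exact ((hGc.pow 2).integrableOn_Ioc)
      · exact Eventually.of_forall fun x => sq_nonneg _
    have r2 : ENNReal.ofReal J ≤ ∫⁻ x in Ioi (0 : ℝ), ‖x ^ (-1 - 0 : ℝ) *
        ∫ t in (0 : ℝ)..x, t ^ (0 : ℝ) * g t‖ₑ ^ 2 := by
      have hint : IntegrableOn (fun x => (prim (prim h) x / x) ^ 2) (Ioc 0 1) := by
        have := (intervalIntegrable_iff_integrableOn_Ioc_of_le zero_le_one).mp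
          (intervalIntegrable_prim_prim_mul 1 hh hh)
        refine this.congr (Eventually.of_forall fun x => ?_)
        simp only
        ring
      rw [hJ, intervalIntegral.integral_of_le zero_le_one, ofReal_integral_eq_lintegral_ofReal hint
        (Eventually.of_forall fun x => sq_nonneg _)]
      refine le_trans (le_of_eq ?_) (lintegral_mono_set (Ioc_subset_Ioi_self (a := 1) (b := 0)))
      refine setLIntegral_congr_fun measurableSet_Ioc fun x hx => ?_
      have e : ∫ t in (0 : ℝ)..x, t ^ (0 : ℝ) * g t = prim (prim h) x := by
        refine intervalIntegral.integral_congr_ae (Eventually.of_forall fun t ht => ?_)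
        rw [uIoc_of_le hx.1.le] at ht
        have ht' : t ∈ Ioc (0 : ℝ) 1 := ⟨ht.1, ht.2.trans hx.2⟩
        rw [hg, indicator_of_mem ht', Real.rpow_zero, one_mul]
      rw [e, sub_zero, Real.rpow_neg_one, Real.enorm_eq_ofReal_abs,
        ← ENNReal.ofReal_pow (abs_nonneg _), sq_abs, div_eq_inv_mul]
    have r3 := r2.trans hardy
    rw [r1, ← ENNReal.ofReal_mul (by positivity),
      ENNReal.ofReal_le_ofReal_iff (by positivity)] at r3
    norm_num at r3
    exact r3
  rw [hform]
  -- If `c_ν ≥ 0` the term in `J` is dropped; otherwise `J ≤ 4 I` gives `I + c_ν J ≥ (1 + 4 c_ν) I =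
  -- 4ν² I`.
  rcases le_total (1 / 4) (ν ^ 2) with h1 | h1
  · rw [min_eq_left (by linarith)]
    nlinarith
  · rw [min_eq_right (by linarith)]
    nlinarith

/-! ### Gluing the two half intervals -/

theorem isOpen_punctured : IsOpen punctured := isOpen_Ioo.union isOpen_Ioo

theorem ne_zero_of_mem_punctured {x : ℝ} (hx : x ∈ punctured) : x ≠ 0 := by
  rcases hx with h | h
  exacts [h.2.ne, h.1.ne']

theorem mu_eq_restrict_punctured : mu = volume.restrict punctured := by
  refine Measure.restrict_congr_set ?_
  have : punctured = Ioo (-1 : ℝ) 1 \ {0} := by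
    ext x
    simp only [punctured, mem_union, mem_Ioo, Set.mem_sdiff, mem_singleton_iff]
    constructor
    · rintro (h | h)
      · exact ⟨⟨h.1, by linarith [h.2]⟩, h.2.ne⟩
      · exact ⟨⟨by linarith [h.1], h.2⟩, h.1.ne'⟩
    · rintro ⟨h1, h2⟩
      rcases lt_or_gt_of_ne h2 with h | h
      · exact Or.inl ⟨h1.1, h⟩
      · exact Or.inr ⟨h, h1.2⟩
  rw [this]
  exact (sdiff_null_ae_eq_self (by simp)).symm

theorem ae_mu_mem_punctured : ∀ᵐ x ∂mu, x ∈ punctured := by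
  rw [mu_eq_restrict_punctured]
  exact ae_restrict_mem isOpen_punctured.measurableSet

theorem ae_mu_iff {p : ℝ → Prop} : (∀ᵐ x ∂mu, p x) ↔
    (∀ᵐ x ∂(volume.restrict (Ioo (0 : ℝ) 1)), p x) ∧
      ∀ᵐ x ∂(volume.restrict (Ioo (-1 : ℝ) 0)), p x := by
  rw [mu_eq_restrict_punctured, punctured, ae_restrict_union_iff, and_comm]

theorem memLp_two_of_half {f : ℝ → ℝ} (h1 : MemLp f 2 (volume.restrict (Ioi 0)))
    (h2 : MemLp (fun x => f (-x)) 2 (volume.restrict (Ioi 0))) : MemLp f 2 := by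
  have mp : MeasurePreserving (fun x : ℝ => -x) (volume.restrict (Iio 0))
      (volume.restrict (Ioi 0)) := by
    have := (Measure.measurePreserving_neg (volume : Measure ℝ)).restrict_preimage
      (measurableSet_Ioi (a := (0 : ℝ)))
    simpa using this
  have h3 : MemLp f 2 (volume.restrict (Iio 0)) := by
    simpa [Function.comp_def] using h2.comp_measurePreserving mp
  rw [← memLp_indicator_iff_restrict measurableSet_Ioi] at h1
  rw [← memLp_indicator_iff_restrict measurableSet_Iio] at h3
  refine (memLp_congr_ae ?_).mp (h1.add h3)
  have : ∀ᵐ x : ℝ, x ≠ 0 := by simp [ae_iff]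
  filter_upwards [this] with x hx
  rcases lt_or_gt_of_ne hx with h | h
  · simp [h, h.le]
  · simp [h, h.le]

theorem memLp_comp_neg {h : ℝ → ℝ} (hh : MemLp h 2) : MemLp (fun x => h (-x)) 2 :=
  hh.comp_measurePreserving (Measure.measurePreserving_neg volume)

theorem memLp_div_sq_mul_prim_prim (c : ℝ) {h : ℝ → ℝ} (hh : MemLp h 2) :
    MemLp (fun x => c / x ^ 2 * prim (prim h) x) 2 := by
  have : MemLp (fun x => prim (prim h) x / x ^ 2) 2 := by
    refine memLp_two_of_half (memLp_prim_prim_div_sq hh) ?_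
    have := memLp_prim_prim_div_sq (memLp_comp_neg hh)
    simpa only [prim_prim_comp_neg, even_two.neg_pow] using this
  refine (memLp_congr_ae (Eventually.of_forall fun x => ?_)).mp (this.const_mul c)
  ring

theorem integral_mu_eq {F : ℝ → ℝ} (hF : Integrable F mu) :
    ∫ x, F x ∂mu = (∫ x in (0 : ℝ)..1, F x) + ∫ x in (0 : ℝ)..1, F (-x) := by
  have hi : ∀ a b : ℝ, -1 ≤ a → a ≤ b → b ≤ 1 → IntervalIntegrable F volume a b := by
    intro a b ha hab hb
    rw [intervalIntegrable_iff_integrableOn_Ioo_of_le hab]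
    exact hF.mono_measure (Measure.restrict_mono (Ioo_subset_Ioo ha hb) le_rfl)
  rw [intervalIntegral.integral_comp_neg, neg_zero, add_comm,
    intervalIntegral.integral_add_adjacent_intervals (hi (-1) 0 (by norm_num) (by norm_num)
      (by norm_num)) (hi 0 1 (by norm_num) (by norm_num) (by norm_num)),
    intervalIntegral.integral_of_le (by norm_num), integral_Ioc_eq_integral_Ioo]

/-! ### The singular functions -/

/-- The function equal to `p` on `(0, ∞)` and to `q` on `(-∞, 0]`. -/
def step (p q x : ℝ) : ℝ := if 0 < x then p else q

theorem step_of_pos {x : ℝ} (p q : ℝ) (hx : 0 < x) : step p q x = p := if_pos hx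

theorem step_of_neg {x : ℝ} (p q : ℝ) (hx : x < 0) : step p q x = q := if_neg hx.le.not_gt

theorem hasDerivAt_step_mul_rpow (p q r : ℝ) {x : ℝ} (hx : x ≠ 0) :
    HasDerivAt (fun x => step p q x * |x| ^ r) (step (r * p) (-(r * q)) x * |x| ^ (r - 1)) x := by
  rcases lt_or_gt_of_ne hx with h | h
  · have e : (fun x => step p q x * |x| ^ r) =ᶠ[𝓝 x] fun x => q * (-x) ^ r := by
      filter_upwards [Iio_mem_nhds h] with y hy
      rw [step_of_neg _ _ hy, abs_of_neg hy]
    refine (((Real.hasDerivAt_rpow_const (p := r) (Or.inl (neg_ne_zero.mpr hx))).comp x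
      (hasDerivAt_neg x)).const_mul q).congr_of_eventuallyEq e |>.congr_deriv ?_
    rw [step_of_neg _ _ h, abs_of_neg h]
    ring
  · have e : (fun x => step p q x * |x| ^ r) =ᶠ[𝓝 x] fun x => p * x ^ r := by
      filter_upwards [Ioi_mem_nhds h] with y hy
      rw [step_of_pos _ _ hy, abs_of_pos hy]
    refine ((Real.hasDerivAt_rpow_const (p := r) (Or.inl hx)).const_mul
      p).congr_of_eventuallyEq e |>.congr_deriv ?_
    rw [step_of_pos _ _ h, abs_of_pos h]
    ring

/-- The singular function with coefficients `c₁⁻, c₂⁻, c₁⁺, c₂⁺`. -/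
def sing (ν c₁m c₂m c₁p c₂p x : ℝ) : ℝ :=
  step c₁p c₁m x * |x| ^ (ν + 1 / 2) + step c₂p c₂m x * |x| ^ (-ν + 1 / 2)

/-- The derivative of `sing` away from `0`. -/
def singDeriv (ν c₁m c₂m c₁p c₂p x : ℝ) : ℝ :=
  step ((ν + 1 / 2) * c₁p) (-((ν + 1 / 2) * c₁m)) x * |x| ^ (ν + 1 / 2 - 1) +
    step ((-ν + 1 / 2) * c₂p) (-((-ν + 1 / 2) * c₂m)) x * |x| ^ (-ν + 1 / 2 - 1)

section Sing

variable (ν c₁m c₂m c₁p c₂p : ℝ)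

theorem hasDerivAt_sing {x : ℝ} (hx : x ≠ 0) :
    HasDerivAt (sing ν c₁m c₂m c₁p c₂p) (singDeriv ν c₁m c₂m c₁p c₂p x) x :=
  (hasDerivAt_step_mul_rpow _ _ _ hx).add (hasDerivAt_step_mul_rpow _ _ _ hx)

/-- Both exponents `s = ±ν + 1/2` satisfy `s (s - 1) = ν² - 1/4`, so singular functions solve the
homogeneous equation off `0` for arbitrary coefficients. -/
theorem hasDerivAt_singDeriv {x : ℝ} (hx : x ≠ 0) :
    HasDerivAt (singDeriv ν c₁m c₂m c₁p c₂p)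
      ((ν ^ 2 - 1 / 4) / x ^ 2 * sing ν c₁m c₂m c₁p c₂p x) x := by
  refine ((hasDerivAt_step_mul_rpow _ _ _ hx).add
    (hasDerivAt_step_mul_rpow _ _ _ hx)).congr_deriv ?_
  have hax : |x| ≠ 0 := abs_ne_zero.mpr hx
  have e : ∀ r : ℝ, |x| ^ (r - 1 - 1) = |x| ^ r / x ^ 2 := by
    intro r
    rw [show r - 1 - 1 = r - (2 : ℕ) by push_cast; ring, Real.rpow_sub_natCast hax, sq_abs]
  rw [sing, e, e]
  rcases lt_or_gt_of_ne hx with h | h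
  · simp only [step_of_neg _ _ h]; ring
  · simp only [step_of_pos _ _ h]; ring

theorem continuousAt_sing {x : ℝ} (hx : x ≠ 0) : ContinuousAt (sing ν c₁m c₂m c₁p c₂p) x :=
  (hasDerivAt_sing ν c₁m c₂m c₁p c₂p hx).continuousAt

theorem hasWeakDerivOn_sing :
    HasWeakDerivOn punctured (sing ν c₁m c₂m c₁p c₂p) (singDeriv ν c₁m c₂m c₁p c₂p) :=
  hasWeakDerivOn_of_hasDerivAt isOpen_punctured
    (fun _ hx => hasDerivAt_sing ν c₁m c₂m c₁p c₂p (ne_zero_of_mem_punctured hx))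
    fun _ hx => (hasDerivAt_singDeriv ν c₁m c₂m c₁p c₂p
      (ne_zero_of_mem_punctured hx)).continuousAt.continuousWithinAt

theorem hasWeakDerivOn_singDeriv :
    HasWeakDerivOn punctured (singDeriv ν c₁m c₂m c₁p c₂p)
      fun x => (ν ^ 2 - 1 / 4) / x ^ 2 * sing ν c₁m c₂m c₁p c₂p x := by
  refine hasWeakDerivOn_of_hasDerivAt isOpen_punctured
    (fun _ hx => hasDerivAt_singDeriv ν c₁m c₂m c₁p c₂p (ne_zero_of_mem_punctured hx)) ?_
  intro x hx
  have hx0 := ne_zero_of_mem_punctured hx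
  exact ((continuousAt_const.div (continuousAt_id.pow 2) (pow_ne_zero 2 hx0)).mul
    (continuousAt_sing ν c₁m c₂m c₁p c₂p hx0)).continuousWithinAt

theorem isSingular_iff {f : ℝ → ℝ} :
    IsSingular ν f c₁m c₂m c₁p c₂p ↔ f =ᵐ[mu] sing ν c₁m c₂m c₁p c₂p := by
  rw [EventuallyEq, ae_mu_iff, IsSingular]
  refine and_congr ?_ ?_
  · constructor <;> intro h <;> filter_upwards [h, ae_restrict_mem measurableSet_Ioo] with x h1 h2
    · rw [h1, sing, step_of_pos _ _ h2.1, step_of_pos _ _ h2.1]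
    · rw [h1, sing, step_of_pos _ _ h2.1, step_of_pos _ _ h2.1]
  · constructor <;> intro h <;> filter_upwards [h, ae_restrict_mem measurableSet_Ioo] with x h1 h2
    · rw [h1, sing, step_of_neg _ _ h2.2, step_of_neg _ _ h2.2]
    · rw [h1, sing, step_of_neg _ _ h2.2, step_of_neg _ _ h2.2]

theorem sing_one : sing ν c₁m c₂m c₁p c₂p 1 = c₁p + c₂p := by
  simp [sing, step]

theorem sing_neg_one : sing ν c₁m c₂m c₁p c₂p (-1) = c₁m + c₂m := by
  rw [sing, step_of_neg _ _ (by norm_num), step_of_neg _ _ (by norm_num)]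
  simp

theorem memLp_sing (hν : ν ∈ Ioo (0 : ℝ) 1) : MemLp (sing ν c₁m c₂m c₁p c₂p) 2 mu := by
  obtain ⟨h0, h1⟩ := hν
  have half : ∀ p q : ℝ, MemLp ((Ioc 0 1).indicator
      fun x : ℝ => p * x ^ (ν + 1 / 2) + q * x ^ (-ν + 1 / 2)) 2 := fun p q => by
    rw [memLp_indicator_iff_restrict measurableSet_Ioc]
    exact ((memLp_rpow (by linarith) 1).const_mul p).add
      ((memLp_rpow (by linarith) 1).const_mul q)
  refine (memLp_congr_ae ?_).mp
    (((half c₁p c₂p).add (memLp_comp_neg (half c₁m c₂m))).restrict (Ioo (-1) 1))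
  filter_upwards [ae_mu_mem_punctured] with x hx
  rcases hx with h | h
  · have e1 : x ∉ Ioc (0 : ℝ) 1 := fun hh => by linarith [hh.1, h.2]
    have e2 : -x ∈ Ioc (0 : ℝ) 1 := ⟨by linarith [h.2], by linarith [h.1]⟩
    rw [Pi.add_apply, indicator_of_notMem e1, indicator_of_mem e2, sing, step_of_neg _ _ h.2,
      step_of_neg _ _ h.2, abs_of_neg h.2, zero_add]
  · have e1 : x ∈ Ioc (0 : ℝ) 1 := ⟨h.1, h.2.le⟩
    have e2 : -x ∉ Ioc (0 : ℝ) 1 := fun hh => by linarith [hh.1, h.1]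
    rw [Pi.add_apply, indicator_of_mem e1, indicator_of_notMem e2, sing, step_of_pos _ _ h.1,
      step_of_pos _ _ h.1, abs_of_pos h.1, add_zero]

end Sing

/-! ### Regular parts -/

/-- A function and the primitive of its weak derivative differ by a constant, which the vanishing
point value at `0` removes. This is used for the derivative and then for the function, with the
second derivative extended by zero. -/
theorem MemH2Tilde.exists_ae_eq_prim_prim {f : ℝ → ℝ} (hf : MemH2Tilde f) :
    ∃ h : ℝ → ℝ, MemLp h 2 ∧ f =ᵐ[mu] prim (prim h) := by
  obtain ⟨-, g, k, -, hk, hfg, hgk, hf0, hg0⟩ := hf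
  have hh : MemLp ((Ioo (-1) 1).indicator k) 2 :=
    (memLp_indicator_iff_restrict measurableSet_Ioo).mpr hk
  refine ⟨_, hh, ?_⟩
  set h := (Ioo (-1) 1).indicator k with hdef
  have hl := locallyIntegrable_of_memLp hh
  have hG := continuous_prim hl
  have hkh : k =ᵐ[mu] h := (indicator_ae_eq_restrict measurableSet_Ioo).symm
  have h0 : (0 : ℝ) ∈ Icc (-1 : ℝ) 1 := by simp
  have key : ∀ (u v : ℝ → ℝ), LocallyIntegrable v → HasWeakDerivOn (Ioo (-1) 1) u v →
      HasPointValue u 0 0 → u =ᵐ[mu] prim v := by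
    intro u v hv huv hu0
    have hs := huv.sub (hasWeakDerivOn_prim hv (Ioo (-1) 1))
    rw [sub_self] at hs
    obtain ⟨C, hC⟩ := exists_ae_eq_const_of_hasWeakDerivOn_zero hs
    have hu : u =ᵐ[mu] fun x => C + prim v x := by
      filter_upwards [hC] with x hx
      rw [← hx, Pi.sub_apply]; ring
    have := hu0.eq_of_ae_eq h0 hu
      (continuous_const.add (continuous_prim hv)).continuousWithinAt
    rw [prim_zero, add_zero] at this
    subst this
    simpa using hu
  have hg := key g h hl (hgk.congr_right hkh) hg0
  exact key f (prim h) hG.locallyIntegrable (hfg.congr_right hg) hf0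

theorem memH2Tilde_prim_prim {h : ℝ → ℝ} (hh : MemLp h 2) : MemH2Tilde (prim (prim h)) := by
  have hl := locallyIntegrable_of_memLp hh
  have hG := continuous_prim hl
  have hR := continuous_prim_prim hh
  have hc : ∀ {f : ℝ → ℝ}, Continuous f → MemLp f 2 mu := fun hf =>
    (memLp_of_continuous hf (-1) 1).mono_measure
      (Measure.restrict_mono Ioo_subset_Ioc_self le_rfl)
  exact ⟨hc hR, prim h, h, hc hG, hh.restrict _, hasWeakDerivOn_prim hG.locallyIntegrable _,
    hasWeakDerivOn_prim hl _,
    ⟨_, EventuallyEq.rfl, hR.continuousWithinAt, prim_zero _⟩,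
    ⟨_, EventuallyEq.rfl, hG.continuousWithinAt, prim_zero _⟩⟩

/-- `f` is the sum of the regular function with second derivative `h` and of a singular function,
subject to the boundary and transmission conditions. -/
structure IsRepr (ν : ℝ) (f h : ℝ → ℝ) (c₁m c₂m c₁p c₂p : ℝ) : Prop where
  memLp : MemLp h 2
  ae_eq : f =ᵐ[mu] fun x => prim (prim h) x + sing ν c₁m c₂m c₁p c₂p x
  left : prim (prim h) (-1) + (c₁m + c₂m) = 0
  right : prim (prim h) 1 + (c₁p + c₂p) = 0
  transmission₁ : c₁m + c₂m + c₁p + c₂p = 0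
  transmission₂ : (ν + 1 / 2) * c₁m + (-ν + 1 / 2) * c₂m =
    (ν + 1 / 2) * c₁p + (-ν + 1 / 2) * c₂p

theorem IsDecomposition.exists_isRepr {ν : ℝ} {f fr fs : L2} {c₁m c₂m c₁p c₂p : ℝ}
    (hd : IsDecomposition ν f fr fs c₁m c₂m c₁p c₂p) :
    ∃ h : ℝ → ℝ, fr =ᵐ[mu] prim (prim h) ∧ IsRepr ν f h c₁m c₂m c₁p c₂p := by
  obtain ⟨h, hh, hfr⟩ := hd.regular.exists_ae_eq_prim_prim
  have hf : f =ᵐ[mu] fun x => prim (prim h) x + sing ν c₁m c₂m c₁p c₂p x := by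
    rw [hd.sum_eq]
    filter_upwards [Lp.coeFn_add fr fs, hfr,
      (isSingular_iff ν c₁m c₂m c₁p c₂p).mp hd.singular] with x h1 h2 h3
    rw [h1, Pi.add_apply, h2, h3]
  have hc : ∀ x : ℝ, x ≠ 0 → ContinuousWithinAt
      (fun x => prim (prim h) x + sing ν c₁m c₂m c₁p c₂p x) (Icc (-1) 1) x := fun x hx =>
    ((continuous_prim_prim hh).continuousAt.add
      (continuousAt_sing ν c₁m c₂m c₁p c₂p hx)).continuousWithinAt
  refine ⟨h, hfr, hh, hf, ?_, ?_, hd.transmission₁, hd.transmission₂⟩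
  · have := hd.left.eq_of_ae_eq (by simp) hf (hc _ (by norm_num))
    rwa [sing_neg_one] at this
  · have := hd.right.eq_of_ae_eq (by simp) hf (hc _ (by norm_num))
    rwa [sing_one] at this

section Repr

variable {ν : ℝ} {f f' : L2} {h k : ℝ → ℝ} {c₁m c₂m c₁p c₂p d₁m d₂m d₁p d₂p : ℝ}

theorem IsRepr.mem_domainA (hν : ν ∈ Ioo (0 : ℝ) 1) (hr : IsRepr ν f h c₁m c₂m c₁p c₂p) :
    f ∈ domainA ν := by
  have hR := memH2Tilde_prim_prim hr.memLp
  have hS := memLp_sing ν c₁m c₂m c₁p c₂p hν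
  refine ⟨hR.1.toLp _, hS.toLp _, c₁m, c₂m, c₁p, c₂p, ?_, hR.congr hR.1.coeFn_toLp.symm,
    (isSingular_iff ν c₁m c₂m c₁p c₂p).mpr hS.coeFn_toLp, ?_, ?_, hr.transmission₁,
    hr.transmission₂⟩
  · rw [← MemLp.toLp_add]
    refine Lp.ext ?_
    filter_upwards [hr.ae_eq, (hR.1.add hS).coeFn_toLp] with x h1 h2
    rw [h1, h2, Pi.add_apply]
  · refine ⟨_, hr.ae_eq, ((continuous_prim_prim hr.memLp).continuousAt.add
      (continuousAt_sing ν c₁m c₂m c₁p c₂p (by norm_num))).continuousWithinAt, ?_⟩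
    rw [sing_neg_one, hr.left]
  · refine ⟨_, hr.ae_eq, ((continuous_prim_prim hr.memLp).continuousAt.add
      (continuousAt_sing ν c₁m c₂m c₁p c₂p (by norm_num))).continuousWithinAt, ?_⟩
    rw [sing_one, hr.right]

theorem IsRepr.isDiffExpr (n : ℕ) (γ : ℝ) (hr : IsRepr ν f h c₁m c₂m c₁p c₂p) :
    IsDiffExpr n γ ν f fun x => -h x + (ν ^ 2 - 1 / 4) / x ^ 2 * prim (prim h) x +
      (n * Real.pi) ^ 2 * |x| ^ (2 * γ) * f x := by
  have hl := locallyIntegrable_of_memLp hr.memLp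
  have hG := continuous_prim hl
  refine ⟨_, _, ((hasWeakDerivOn_prim hG.locallyIntegrable punctured).add
    (hasWeakDerivOn_sing ν c₁m c₂m c₁p c₂p)).congr_left
    (EventuallyEq.symm (ae_punctured hr.ae_eq)),
    (hasWeakDerivOn_prim hl punctured).add (hasWeakDerivOn_singDeriv ν c₁m c₂m c₁p c₂p), ?_⟩
  filter_upwards [hr.ae_eq] with x hx
  rw [Pi.add_apply]
  -- Only the `f` in the inverse-square term is expanded: its singular part cancels the second
  -- derivative of `sing`.
  nth_rewrite 2 [hx]
  ring

theorem IsDiffExpr.ae_eq {n : ℕ} {γ ν : ℝ} {f u u' : ℝ → ℝ} (hu : IsDiffExpr n γ ν f u)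
    (hu' : IsDiffExpr n γ ν f u') : u =ᵐ[mu] u' := by
  obtain ⟨g, k, h1, h2, h3⟩ := hu
  obtain ⟨g', k', h1', h2', h3'⟩ := hu'
  have e1 := h1.ae_eq isOpen_punctured h1' EventuallyEq.rfl
  have e2 := h2.ae_eq isOpen_punctured h2' e1
  rw [← mu_eq_restrict_punctured] at e2
  filter_upwards [h3, h3', e2] with x a1 a2 a3
  rw [a1, a2, a3]

/-- Green's formula for `-∂² + c_ν / x²`. -/
theorem IsRepr.integral_expr_mul (hν : ν ∈ Ioo (0 : ℝ) 1) (hr : IsRepr ν f h c₁m c₂m c₁p c₂p)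
    (hr' : IsRepr ν f' k d₁m d₂m d₁p d₂p) :
    ∫ x, (-h x + (ν ^ 2 - 1 / 4) / x ^ 2 * prim (prim h) x) * f' x ∂mu =
      halfForm (ν ^ 2 - 1 / 4) h k +
        halfForm (ν ^ 2 - 1 / 4) (fun x => h (-x)) fun x => k (-x) := by
  have hu : MemLp (fun x => -h x + (ν ^ 2 - 1 / 4) / x ^ 2 * prim (prim h) x) 2 mu :=
    (hr.memLp.neg.add (memLp_div_sq_mul_prim_prim _ hr.memLp)).restrict _
  have e : (fun x => (-h x + (ν ^ 2 - 1 / 4) / x ^ 2 * prim (prim h) x) * f' x) =ᵐ[mu]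
      fun x => (-h x + (ν ^ 2 - 1 / 4) / x ^ 2 * prim (prim h) x) *
        (prim (prim k) x + sing ν d₁m d₂m d₁p d₂p x) := by
    filter_upwards [hr'.ae_eq] with x hx
    rw [hx]
  have hint := (hu.integrable_mul (Lp.memLp f')).congr e
  rw [integral_congr_ae e, integral_mu_eq hint]
  have ep := SingularGrushin.integral_expr_mul hν hr.memLp hr'.memLp d₁p d₂p hr'.right
  have em := SingularGrushin.integral_expr_mul hν (memLp_comp_neg hr.memLp)
    (memLp_comp_neg hr'.memLp) d₁m d₂m (by rw [prim_prim_comp_neg]; exact hr'.left)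
  have ep' : ∫ x in (0 : ℝ)..1, (-h x + (ν ^ 2 - 1 / 4) / x ^ 2 * prim (prim h) x) *
      (prim (prim k) x + sing ν d₁m d₂m d₁p d₂p x) = ∫ x in (0 : ℝ)..1,
      (-h x + (ν ^ 2 - 1 / 4) / x ^ 2 * prim (prim h) x) *
        (prim (prim k) x + (d₁p * x ^ (ν + 1 / 2) + d₂p * x ^ (-ν + 1 / 2))) := by
    refine intervalIntegral.integral_congr_ae (Eventually.of_forall fun x hx => ?_)
    rw [uIoc_of_le zero_le_one] at hx
    rw [sing, step_of_pos _ _ hx.1, step_of_pos _ _ hx.1, abs_of_pos hx.1]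
  have em' : ∫ x in (0 : ℝ)..1, (-h (-x) + (ν ^ 2 - 1 / 4) / (-x) ^ 2 * prim (prim h) (-x)) *
      (prim (prim k) (-x) + sing ν d₁m d₂m d₁p d₂p (-x)) = ∫ x in (0 : ℝ)..1,
      (-h (-x) + (ν ^ 2 - 1 / 4) / x ^ 2 * prim (prim fun x => h (-x)) x) *
        (prim (prim fun x => k (-x)) x +
          (d₁m * x ^ (ν + 1 / 2) + d₂m * x ^ (-ν + 1 / 2))) := by
    refine intervalIntegral.integral_congr_ae (Eventually.of_forall fun x hx => ?_)
    rw [uIoc_of_le zero_le_one] at hx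
    have hx' : -x < 0 := neg_lt_zero.mpr hx.1
    rw [sing, step_of_neg _ _ hx', step_of_neg _ _ hx', abs_of_neg hx', neg_neg,
      prim_prim_comp_neg, prim_prim_comp_neg, even_two.neg_pow]
  rw [ep', em', ep, em, prim_prim_comp_neg]
  -- By the second transmission condition the two boundary terms share one factor, multiplied by
  -- `prim (prim h) 1 + prim (prim h) (-1)`. This sum is zero by the Dirichlet conditions and the
  -- first transmission condition.
  linear_combination ((ν + 1 / 2) * d₁p + (-ν + 1 / 2) * d₂p) *
    (hr.right + hr.left - hr.transmission₁) + prim (prim h) (-1) * hr'.transmission₂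

theorem IsRepr.integral_expr_mul_comm (hν : ν ∈ Ioo (0 : ℝ) 1)
    (hr : IsRepr ν f h c₁m c₂m c₁p c₂p) (hr' : IsRepr ν f' k d₁m d₂m d₁p d₂p) :
    ∫ x, (-h x + (ν ^ 2 - 1 / 4) / x ^ 2 * prim (prim h) x) * f' x ∂mu =
      ∫ x, (-k x + (ν ^ 2 - 1 / 4) / x ^ 2 * prim (prim k) x) * f x ∂mu := by
  rw [hr.integral_expr_mul hν hr', hr'.integral_expr_mul hν hr, halfForm_comm,
    halfForm_comm _ fun x => h (-x)]

theorem IsRepr.le_integral_expr_mul (hν : ν ∈ Ioo (0 : ℝ) 1)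
    (hr : IsRepr ν f h c₁m c₂m c₁p c₂p) :
    min 1 (4 * ν ^ 2) * ∫ x, prim h x ^ 2 ∂mu ≤
      ∫ x, (-h x + (ν ^ 2 - 1 / 4) / x ^ 2 * prim (prim h) x) * f x ∂mu := by
  have hi : Integrable (fun x => prim h x ^ 2) mu :=
    (((continuous_prim (locallyIntegrable_of_memLp hr.memLp)).pow 2).integrableOn_Ioc
      (a := -1) (b := 1)).mono_set Ioo_subset_Ioc_self
  rw [hr.integral_expr_mul hν hr, integral_mu_eq hi, mul_add]
  refine add_le_add (min_mul_le_halfForm hr.memLp) ?_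
  refine le_trans (le_of_eq ?_) (min_mul_le_halfForm (memLp_comp_neg hr.memLp))
  simp only [prim_comp_neg, even_two.neg_pow]

end Repr

/-! ### Solving the equation -/

theorem tendsto_rpow_mul_prim_zero {r s : ℝ} (hs : -1 / 2 < s) (hr : 0 < r + (s + 1 / 2))
    {w : ℝ → ℝ} (hw : MemLp w 2) :
    Tendsto (fun x => x ^ r * prim (fun t => t ^ s * w t) x) (𝓝[>] 0) (𝓝 0) := by
  obtain ⟨C, hC⟩ := exists_abs_intervalIntegral_rpow_mul_le hs hw
  refine tendsto_zero_of_abs_le_rpow (C := C) hr fun x hx => ?_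
  rw [abs_mul, abs_of_pos (Real.rpow_pos_of_pos hx r), Real.rpow_add hx, mul_left_comm]
  gcongr
  exact hC x hx

/-- Variation of constants on `(0, 1)`. -/
theorem exists_solution_half {ν : ℝ} (hν : ν ∈ Ioo (0 : ℝ) 1) {w : ℝ → ℝ} (hw : MemLp w 2)
    (hw0 : ∀ t ∉ Ioc (0 : ℝ) 1, w t = 0) :
    ∃ h : ℝ → ℝ, MemLp h 2 ∧
      (∀ x, 0 < x → -h x + (ν ^ 2 - 1 / 4) / x ^ 2 * prim (prim h) x = w x) ∧
      prim (prim h) 1 = (2 * ν)⁻¹ *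
        ∫ t in (0 : ℝ)..1, (t ^ (ν + 1 / 2) - t ^ (-ν + 1 / 2)) * w t := by
  obtain ⟨hν0, hν1⟩ := hν
  set a : ℝ := ν + 1 / 2 with ha
  set b : ℝ := -ν + 1 / 2 with hb
  have ha' : -1 / 2 < a := by linarith
  have hb' : -1 / 2 < b := by linarith
  have hloc : ∀ s : ℝ, -1 / 2 < s → Integrable fun t => t ^ s * w t := by
    intro s hs
    refine (integrableOn_iff_integrable_of_support_subset fun t ht => ?_).mp
      (integrableOn_rpow_mul hs (x := 1) (hw.restrict _))
    by_contra hcon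
    exact ht (by simp [hw0 t hcon])
  -- Homogeneous solutions are `x^a` and `x^b`, with `a + b = 1` and Wronskian `b - a = -2ν`.
  -- Starting both integrals at `0` selects the solution `R` that is a regular part.
  set U : ℝ → ℝ := prim fun t => t ^ b * w t with hU
  set V : ℝ → ℝ := prim fun t => t ^ a * w t with hV
  set R : ℝ → ℝ := fun x => (2 * ν)⁻¹ * (x ^ b * V x) + -((2 * ν)⁻¹ * (x ^ a * U x)) with hR
  set G : ℝ → ℝ := fun x => ((2 * ν)⁻¹ * b) * (x ^ (b - 1) * V x) +
    -(((2 * ν)⁻¹ * a) * (x ^ (a - 1) * U x)) with hG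
  -- This is `(c_ν / x²) R - w`, written with `b - 2 = -1 - a` and `a - 2 = -1 - b` so that each
  -- term is a Hardy average of `w` and hence in `L²`.
  set h : ℝ → ℝ := (Ioi 0).indicator fun x =>
    (ν ^ 2 - 1 / 4) * ((2 * ν)⁻¹ * (x ^ (-1 - a) * V x) - (2 * ν)⁻¹ * (x ^ (-1 - b) * U x)) - w x
    with hh
  have h_pos : ∀ x, 0 < x → h x = (ν ^ 2 - 1 / 4) / x ^ 2 * R x - w x := by
    intro x hx
    rw [hh, indicator_of_mem (mem_Ioi.mpr hx), hR,
      show -1 - a = b - (2 : ℕ) by rw [ha, hb]; push_cast; ring,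
      show -1 - b = a - (2 : ℕ) by rw [ha, hb]; push_cast; ring,
      Real.rpow_sub_natCast hx.ne', Real.rpow_sub_natCast hx.ne']
    ring
  have hhL : MemLp h 2 := by
    rw [hh, memLp_indicator_iff_restrict measurableSet_Ioi]
    exact ((((memLp_hardy ha' hw).const_mul _).sub
      ((memLp_hardy hb' hw).const_mul _)).const_mul _).sub (hw.restrict _)
  have acp : ∀ {r s ε x : ℝ}, -1 / 2 < s → 0 < ε → 0 < x → AbsolutelyContinuousOnInterval
      (fun x => x ^ r * prim (fun t => t ^ s * w t) x) ε x := fun hs hε hx =>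
    (absolutelyContinuousOnInterval_rpow hε hx _).fun_mul
      (absolutelyContinuousOnInterval_prim (hloc _ hs).locallyIntegrable _ _)
  have dU := ae_hasDerivAt_prim (hloc b hb').locallyIntegrable
  have dV := ae_hasDerivAt_prim (hloc a ha').locallyIntegrable
  have dp : ∀ (r : ℝ) {t : ℝ}, 0 < t → HasDerivAt (fun x : ℝ => x ^ r) (r * (t ^ r / t)) t := by
    intro r t ht
    have := Real.hasDerivAt_rpow_const (p := r) (Or.inl ht.ne')
    rwa [Real.rpow_sub_one ht.ne'] at this
  have hab : ∀ {t : ℝ}, 0 < t → t ^ a * t ^ b = t := fun {t} ht => by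
    rw [← Real.rpow_add ht, show a + b = 1 by rw [ha, hb]; ring, Real.rpow_one]
  -- Differentiating `V` and `U` inside `G` contributes `(b - a) / (2ν) * w = -w`; inside `R`,
  -- below, their contributions cancel.
  have hGh : ∀ x, 0 < x → prim h x = G x := by
    intro x hx
    refine intervalIntegral_eq_of_tendsto_zero hx ?_ (fun ε hε => ?_) ?_ ?_
    · exact ((locallyIntegrable_of_memLp hhL).integrableOn_isCompact
        isCompact_Icc).mono_set Ioc_subset_Icc_self
    · exact ((acp ha' hε hx).const_mul _).fun_add ((acp hb' hε hx).const_mul _).fun_neg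
    · filter_upwards [dU, dV] with t h1 h2 ht
      refine ((((dp (b - 1) ht).mul h2).const_mul _).add
        (((dp (a - 1) ht).mul h1).const_mul _).neg).congr_deriv ?_
      rw [h_pos t ht, hR, Real.rpow_sub_one ht.ne', Real.rpow_sub_one ht.ne']
      simp only
      have e := hab ht
      have e' : t ^ b = t / t ^ a := by
        rw [eq_div_iff (Real.rpow_pos_of_pos ht a).ne', mul_comm, e]
      have hp := (Real.rpow_pos_of_pos ht a).ne'
      rw [e', ← hU, ← hV]
      field_simp
      rw [ha, hb]
      ring
    · have t1 := tendsto_rpow_mul_prim_zero (r := b - 1) ha' (by rw [ha, hb]; linarith) hw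
      have t2 := tendsto_rpow_mul_prim_zero (r := a - 1) hb' (by rw [ha, hb]; linarith) hw
      have := (t1.const_mul ((2 * ν)⁻¹ * b)).add (t2.const_mul ((2 * ν)⁻¹ * a)).neg
      rwa [mul_zero, mul_zero, neg_zero, add_zero] at this
  have hhc := continuous_prim (locallyIntegrable_of_memLp hhL)
  have hRh : ∀ x, 0 < x → prim (prim h) x = R x := by
    intro x hx
    refine intervalIntegral_eq_of_tendsto_zero hx hhc.integrableOn_Ioc (fun ε hε => ?_) ?_ ?_
    · exact ((acp ha' hε hx).const_mul _).fun_add ((acp hb' hε hx).const_mul _).fun_neg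
    · filter_upwards [dU, dV] with t h1 h2 ht
      refine ((((dp b ht).mul h2).const_mul _).add
        (((dp a ht).mul h1).const_mul _).neg).congr_deriv ?_
      rw [hGh t ht, hG]
      simp only
      rw [Real.rpow_sub_one ht.ne', Real.rpow_sub_one ht.ne', ← hU, ← hV]
      ring
    · have t1 := tendsto_rpow_mul_prim_zero (r := b) ha' (by rw [ha, hb]; linarith) hw
      have t2 := tendsto_rpow_mul_prim_zero (r := a) hb' (by rw [ha, hb]; linarith) hw
      have := (t1.const_mul (2 * ν)⁻¹).add (t2.const_mul (2 * ν)⁻¹).neg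
      rwa [mul_zero, neg_zero, add_zero] at this
  refine ⟨h, hhL, fun x hx => ?_, ?_⟩
  · rw [hRh x hx, h_pos x hx]; ring
  · rw [hRh 1 one_pos, hR]
    simp only [Real.one_rpow, one_mul, sub_mul]
    rw [intervalIntegral.integral_sub (hloc a ha').intervalIntegrable
      (hloc b hb').intervalIntegrable, hU, hV]
    simp only [prim]
    ring

theorem prim_congr {u v : ℝ → ℝ} (huv : ∀ t, 0 < t → u t = v t) {x : ℝ} (hx : 0 ≤ x) :
    prim u x = prim v x := by
  refine intervalIntegral.integral_congr_ae (Eventually.of_forall fun t ht => ?_)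
  rw [uIoc_of_le hx] at ht
  exact huv t ht.1

theorem prim_prim_congr {u v : ℝ → ℝ} (huv : ∀ t, 0 < t → u t = v t) {x : ℝ} (hx : 0 ≤ x) :
    prim (prim u) x = prim (prim v) x :=
  prim_congr (fun _ ht => prim_congr huv ht.le) hx

/-- `|x|^(ν+1/2) - |x|^(-ν+1/2)`, which spans the kernel of `-∂² + c_ν / x²`. -/
def kernelFun (ν : ℝ) : ℝ → ℝ := sing ν 1 (-1) 1 (-1)

theorem memLp_kernelFun {ν : ℝ} (hν : ν ∈ Ioo (0 : ℝ) 1) : MemLp (kernelFun ν) 2 mu :=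
  memLp_sing ν _ _ _ _ hν

theorem isRepr_kernelFun {ν : ℝ} (hν : ν ∈ Ioo (0 : ℝ) 1) :
    IsRepr ν ((memLp_kernelFun hν).toLp _) 0 1 (-1) 1 (-1) where
  memLp := MemLp.zero
  ae_eq := by
    have h0 : prim 0 = 0 := by ext x; simp [prim]
    filter_upwards [(memLp_kernelFun hν).coeFn_toLp] with x hx
    rw [hx, h0, h0]
    simp [kernelFun]
  left := by simp [prim]
  right := by simp [prim]
  transmission₁ := by norm_num
  transmission₂ := rfl

/-- `-∂² + c_ν / x²` maps its domain onto the orthogonal complement of `kernelFun ν`. -/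
theorem exists_isRepr_of_integral_kernelFun_eq_zero {ν : ℝ} (hν : ν ∈ Ioo (0 : ℝ) 1) (w : L2)
    (hw : ∫ x, kernelFun ν x * w x ∂mu = 0) :
    ∃ (f : L2) (h : ℝ → ℝ) (c₁m c₂m c₁p c₂p : ℝ), IsRepr ν f h c₁m c₂m c₁p c₂p ∧
      w =ᵐ[mu] fun x => -h x + (ν ^ 2 - 1 / 4) / x ^ 2 * prim (prim h) x := by
  set W : ℝ → ℝ := (Ioo (-1) 1).indicator w with hW
  have hWL : MemLp W 2 := (memLp_indicator_iff_restrict measurableSet_Ioo).mpr (Lp.memLp w)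
  have hwW : w =ᵐ[mu] W := (indicator_ae_eq_restrict measurableSet_Ioo).symm
  obtain ⟨hp, hpL, hp1, hp2⟩ := exists_solution_half hν
    (hWL.indicator (measurableSet_Ioc (a := (0 : ℝ)) (b := 1)))
    fun t ht => indicator_of_notMem ht _
  obtain ⟨hm, hmL, hm1, hm2⟩ := exists_solution_half hν
    ((memLp_comp_neg hWL).indicator (measurableSet_Ioc (a := (0 : ℝ)) (b := 1)))
    fun t ht => indicator_of_notMem ht _
  set h : ℝ → ℝ := fun x => if 0 < x then hp x else hm (-x) with hh
  have h_pos : ∀ x, 0 < x → h x = hp x := fun x hx => if_pos hx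
  have h_neg : ∀ x, 0 < x → h (-x) = hm x := fun x hx => by
    simp only [hh]
    rw [if_neg (by linarith), neg_neg]
  have hL : MemLp h 2 := by
    refine memLp_two_of_half ((memLp_congr_ae ?_).mp (hpL.restrict (Ioi 0)))
      ((memLp_congr_ae ?_).mp (hmL.restrict (Ioi 0)))
    · filter_upwards [ae_restrict_mem measurableSet_Ioi] with x hx using (h_pos x hx).symm
    · filter_upwards [ae_restrict_mem measurableSet_Ioi] with x hx using (h_neg x hx).symm
  have R_pos : ∀ x, 0 ≤ x → prim (prim h) x = prim (prim hp) x := fun x hx =>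
    prim_prim_congr h_pos hx
  have R_neg : ∀ x, 0 ≤ x → prim (prim h) (-x) = prim (prim hm) x := fun x hx => by
    rw [← prim_prim_comp_neg]
    exact prim_prim_congr h_neg hx
  -- The solution formula gives this sum as `(2ν)⁻¹` times the pairing of `w` with `kernelFun ν`. It
  -- is the only solvability condition.
  have hsum : prim (prim h) 1 + prim (prim h) (-1) = 0 := by
    have hint : Integrable (fun x => kernelFun ν x * W x) mu :=
      (memLp_kernelFun hν).integrable_mul (hWL.restrict _)
    have e0 : ∫ x, kernelFun ν x * w x ∂mu = ∫ x, kernelFun ν x * W x ∂mu := by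
      refine integral_congr_ae ?_
      filter_upwards [hwW] with x hx
      rw [hx]
    rw [e0, integral_mu_eq hint] at hw
    rw [R_pos 1 zero_le_one, R_neg 1 zero_le_one, hp2, hm2, ← mul_add]
    refine mul_eq_zero_of_right _ (Eq.trans ?_ hw)
    congr 1
    · refine intervalIntegral.integral_congr_ae (Eventually.of_forall fun t ht => ?_)
      rw [uIoc_of_le zero_le_one] at ht
      rw [indicator_of_mem ht, kernelFun, sing, step_of_pos _ _ ht.1, step_of_pos _ _ ht.1,
        abs_of_pos ht.1]
      ring
    · refine intervalIntegral.integral_congr_ae (Eventually.of_forall fun t ht => ?_)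
      rw [uIoc_of_le zero_le_one] at ht
      have ht' : -t < 0 := neg_lt_zero.mpr ht.1
      rw [indicator_of_mem ht, kernelFun, sing, step_of_neg _ _ ht', step_of_neg _ _ ht',
        abs_of_neg ht', neg_neg]
      ring
  set P := prim (prim h) 1 with hP
  set M := prim (prim h) (-1) with hM
  have hν0 : ν ≠ 0 := hν.1.ne'
  -- On each side the coefficients solve the Dirichlet condition together with `(ν + 1/2) c₁ + (-ν +
  -- 1/2) c₂ = 0`. Both sides of the second transmission condition are then zero.
  set c₁m := (-ν + 1 / 2) * M / (2 * ν) with c1m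
  set c₂m := -((ν + 1 / 2) * M) / (2 * ν) with c2m
  set c₁p := (-ν + 1 / 2) * P / (2 * ν) with c1p
  set c₂p := -((ν + 1 / 2) * P) / (2 * ν) with c2p
  have bm : M + (c₁m + c₂m) = 0 := by rw [c1m, c2m]; field_simp; ring
  have bp : P + (c₁p + c₂p) = 0 := by rw [c1p, c2p]; field_simp; ring
  have hf : MemLp (fun x => prim (prim h) x + sing ν c₁m c₂m c₁p c₂p x) 2 mu :=
    (memH2Tilde_prim_prim hL).1.add (memLp_sing ν _ _ _ _ hν)
  refine ⟨hf.toLp _, h, c₁m, c₂m, c₁p, c₂p, ⟨hL, hf.coeFn_toLp, bm, bp, ?_, ?_⟩, ?_⟩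
  · linear_combination bm + bp - hsum
  · rw [c1m, c2m, c1p, c2p]; field_simp; ring
  · filter_upwards [hwW, ae_mu_mem_punctured] with x hx hxp
    rw [hx]
    rcases hxp with hx1 | hx1
    · obtain ⟨y, rfl⟩ : ∃ y, x = -y := ⟨-x, (neg_neg x).symm⟩
      have hy : 0 < y := by linarith [hx1.2]
      rw [h_neg y hy, R_neg y hy.le, even_two.neg_pow, hm1 y hy,
        indicator_of_mem (show y ∈ Ioc (0 : ℝ) 1 from ⟨hy, by linarith [hx1.1]⟩)]
    · rw [h_pos x hx1.1, R_pos x hx1.1.le, hp1 x hx1.1,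
        indicator_of_mem (show x ∈ Ioc (0 : ℝ) 1 from ⟨hx1.1, hx1.2.le⟩)]

/-! ### Self-adjointness -/

/-- A symmetric operator `A - B` whose range contains the orthogonal complement of a vector of its
kernel is self-adjoint, and so is `A` if `B` is symmetric and everywhere defined. -/
theorem isSelfAdjoint_of_symmetric_of_range {H : Type*} [NormedAddCommGroup H]
    [InnerProductSpace ℝ H] [CompleteSpace H] (A : H →ₗ.[ℝ] H) (B : H → H)
    (hB : ∀ f g : H, ⟪B f, g⟫ = ⟪f, B g⟫)
    (hT : ∀ f g : A.domain, ⟪A f - B f, (g : H)⟫ = ⟪(f : H), A g - B g⟫)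
    (k : A.domain) (hk : A k - B k = 0)
    (hr : ∀ w : H, ⟪w, (k : H)⟫ = 0 → ∃ f : A.domain, A f - B f = w) :
    IsSelfAdjoint A := by
  -- Anything orthogonal to the range of `T = A - B` is a multiple of `k`: after subtracting its
  -- projection on `k`, it lies in the range and is orthogonal to it.
  have hker : ∀ z : H, (∀ u : A.domain, ⟪A u - B u, z⟫ = 0) → ∃ c : ℝ, z = c • (k : H) := by
    intro z hz
    have hTk : ∀ u : A.domain, ⟪A u - B u, (k : H)⟫ = 0 := fun u => by
      rw [hT u k, hk, inner_zero_right]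
    by_cases hk0 : (k : H) = 0
    · obtain ⟨u, hu⟩ := hr z (by rw [hk0, inner_zero_right])
      have := hz u
      rw [hu, inner_self_eq_zero] at this
      exact ⟨0, by rw [this, zero_smul]⟩
    · refine ⟨⟪z, (k : H)⟫ / ⟪(k : H), (k : H)⟫, ?_⟩
      set c := ⟪z, (k : H)⟫ / ⟪(k : H), (k : H)⟫ with hc
      have h0 : ⟪z - c • (k : H), (k : H)⟫ = 0 := by
        rw [inner_sub_left, real_inner_smul_left, hc,
          div_mul_cancel₀ _ (inner_self_ne_zero.mpr hk0), sub_self]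
      obtain ⟨u, hu⟩ := hr _ h0
      have h1 : ⟪z - c • (k : H), z - c • (k : H)⟫ = 0 := by
        nth_rewrite 1 [← hu]
        rw [inner_sub_right, real_inner_smul_right, hz, hTk, mul_zero, sub_zero]
      exact sub_eq_zero.mp (inner_self_eq_zero.mp h1)
  have hsymm : A.IsFormalAdjoint A := by
    intro f g
    have := hT f g
    rw [inner_sub_left, inner_sub_right, hB] at this
    linarith
  -- A vector `z` orthogonal to the domain is orthogonal to `k`, so `z = T f`. By symmetry `f` is
  -- orthogonal to the range, hence `f` is a multiple of `k` and `z = 0`.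
  have hdense : Dense (A.domain : Set H) := by
    rw [Submodule.dense_iff_topologicalClosure_eq_top, Submodule.topologicalClosure_eq_top_iff,
      Submodule.eq_bot_iff]
    intro z hz
    rw [Submodule.mem_orthogonal'] at hz
    obtain ⟨f, hf⟩ := hr z (hz k k.2)
    obtain ⟨c, hc⟩ := hker f fun u => by
      rw [real_inner_comm, ← hT f u, hf, hz u u.2]
    have hfk : f = c • k := Subtype.ext hc
    -- Homogeneity of `B` is not assumed; it follows from symmetry.
    have hBc : B (c • (k : H)) = c • B k := ext_inner_right ℝ fun v => by
      rw [hB, real_inner_smul_left, real_inner_smul_left, hB]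
    rw [← hf, hfk, LinearPMap.map_smul, Submodule.coe_smul, hBc, ← smul_sub, hk, smul_zero]
  rw [LinearPMap.isSelfAdjoint_def]
  have hle : A ≤ A.adjoint := hsymm.le_adjoint hdense
  refine (LinearPMap.eq_of_le_of_domain_eq hle (le_antisymm hle.1 fun g hg => ?_)).symm
  have hadj : ∀ u : A.domain, ⟪A.adjoint ⟨g, hg⟩, (u : H)⟫ = ⟪g, A u⟫ := fun u =>
    A.adjoint_isFormalAdjoint hdense ⟨g, hg⟩ u
  set w := A.adjoint ⟨g, hg⟩
  have h1 : ∀ u : A.domain, ⟪w - B g, (u : H)⟫ = ⟪g, A u - B u⟫ := fun u => by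
    rw [inner_sub_left, inner_sub_right, hadj, hB]
  -- For `g` in the domain of the adjoint, `A* g - B g` is orthogonal to `k`, hence equals `T f` for
  -- some `f` in the domain. Then `g - f` is orthogonal to the range, hence a multiple of `k`, and
  -- `g` lies in the domain.
  obtain ⟨f, hf⟩ := hr (w - B g) (by rw [h1, hk, inner_zero_right])
  obtain ⟨c, hc⟩ := hker (g - f) fun u => by
    rw [inner_sub_right, hT u f, hf, real_inner_comm, ← h1, real_inner_comm, sub_self]
  rw [sub_eq_iff_eq_add.mp hc]
  exact add_mem (A.domain.smul_mem c k.2) f.2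

/-! ### The operator -/

theorem memLp_potential (n : ℕ) {γ : ℝ} (hγ : 0 < γ) (f : L2) :
    MemLp (fun x => (n * Real.pi) ^ 2 * |x| ^ (2 * γ) * f x) 2 mu := by
  have hm : Measurable fun x : ℝ => (n * Real.pi) ^ 2 * |x| ^ (2 * γ) := by fun_prop
  refine (Lp.memLp f).of_le_mul (c := (n * Real.pi) ^ 2)
    (hm.aestronglyMeasurable.mul (Lp.aestronglyMeasurable f)) ?_
  filter_upwards [ae_restrict_mem measurableSet_Ioo] with x hx
  rw [norm_mul, Real.norm_of_nonneg (by positivity)]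
  gcongr
  refine mul_le_of_le_one_right (by positivity) ?_
  exact Real.rpow_le_one (abs_nonneg x) (abs_lt.mpr hx).le (by positivity)

/-- Multiplication by the potential `(nπ)² |x|^(2γ)`. -/
def potential (n : ℕ) {γ : ℝ} (hγ : 0 < γ) (f : L2) : L2 := (memLp_potential n hγ f).toLp _

theorem inner_L2_eq (f g : L2) : ⟪f, g⟫ = ∫ x, f x * g x ∂mu := by
  rw [L2.inner_def]
  refine integral_congr_ae (Eventually.of_forall fun x => ?_)
  simp [mul_comm]

theorem inner_potential (n : ℕ) {γ : ℝ} (hγ : 0 < γ) (f g : L2) :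
    ⟪potential n hγ f, g⟫ = ∫ x, (n * Real.pi) ^ 2 * |x| ^ (2 * γ) * f x * g x ∂mu := by
  rw [inner_L2_eq]
  refine integral_congr_ae ?_
  filter_upwards [(memLp_potential n hγ f).coeFn_toLp] with x hx
  rw [potential, hx]

theorem inner_potential_comm (n : ℕ) {γ : ℝ} (hγ : 0 < γ) (f g : L2) :
    ⟪potential n hγ f, g⟫ = ⟪f, potential n hγ g⟫ := by
  rw [real_inner_comm (potential n hγ g), inner_potential, inner_potential]
  refine integral_congr_ae (Eventually.of_forall fun x => ?_)
  ring

/-- Uniqueness of weak derivatives. It ensures that the operator obtained from the graph really acts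
by the differential expression. -/
theorem graphA_single_valued (n : ℕ) (γ ν : ℝ) (x : L2 × L2) (hx : x ∈ graphA n γ ν)
    (h0 : x.1 = 0) : x.2 = 0 := by
  have h1 : IsDiffExpr n γ ν x.1 x.2 := hx.2
  have h2 : IsDiffExpr n γ ν x.1 (0 : L2) := by
    rw [h0]
    exact (isDiffExpr_zero n γ ν).congr (Lp.coeFn_zero ℝ 2 mu).symm (Lp.coeFn_zero ℝ 2 mu).symm
  exact Lp.ext (h1.ae_eq h2)

theorem mk_operatorA_mem_graphA (n : ℕ) (γ ν : ℝ) (f : (operatorA n γ ν).domain) :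
    ((f : L2), operatorA n γ ν f) ∈ graphA n γ ν :=
  Submodule.mem_graph_toLinearPMap (graphA_single_valued n γ ν) f

theorem isDiffExpr_operatorA (n : ℕ) (γ ν : ℝ) (f : (operatorA n γ ν).domain) :
    IsDiffExpr n γ ν (f : L2) (operatorA n γ ν f) :=
  (mk_operatorA_mem_graphA n γ ν f).2

theorem exists_isRepr_of_mem_domainA {ν : ℝ} {f : L2} (hf : f ∈ domainA ν) :
    ∃ (h : ℝ → ℝ) (c₁m c₂m c₁p c₂p : ℝ), IsRepr ν f h c₁m c₂m c₁p c₂p := by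
  obtain ⟨fr, fs, c₁m, c₂m, c₁p, c₂p, hd⟩ := hf
  obtain ⟨h, -, hr⟩ := hd.exists_isRepr
  exact ⟨h, c₁m, c₂m, c₁p, c₂p, hr⟩

/-- The substance is that the differential expression maps `D(A)` into `L²`: the singular part
enters only through the bounded potential, and Hardy controls the regular part. -/
theorem operatorA_domain (n : ℕ) {γ : ℝ} (hγ : 0 < γ) (ν : ℝ) :
    (operatorA n γ ν).domain = domainA ν := by
  refine le_antisymm ?_ fun f hf => ?_
  · rintro _ ⟨p, hp, rfl⟩
    exact hp.1
  · obtain ⟨h, _, _, _, _, hr⟩ := exists_isRepr_of_mem_domainA hf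
    have hu : MemLp (fun x => -h x + (ν ^ 2 - 1 / 4) / x ^ 2 * prim (prim h) x +
        (n * Real.pi) ^ 2 * |x| ^ (2 * γ) * f x) 2 mu :=
      ((hr.memLp.neg.add (memLp_div_sq_mul_prim_prim _ hr.memLp)).restrict _).add
        (memLp_potential n hγ f)
    exact ⟨(f, hu.toLp _), ⟨hf, (hr.isDiffExpr n γ).congr EventuallyEq.rfl hu.coeFn_toLp.symm⟩,
      rfl⟩

theorem IsRepr.operatorA_sub_potential_ae_eq {n : ℕ} {γ ν : ℝ} (hγ : 0 < γ)
    {f : (operatorA n γ ν).domain} {h : ℝ → ℝ} {c₁m c₂m c₁p c₂p : ℝ}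
    (hr : IsRepr ν (f : L2) h c₁m c₂m c₁p c₂p) :
    (operatorA n γ ν f - potential n hγ f : L2) =ᵐ[mu]
      fun x => -h x + (ν ^ 2 - 1 / 4) / x ^ 2 * prim (prim h) x := by
  filter_upwards [Lp.coeFn_sub (operatorA n γ ν f) (potential n hγ f),
    (isDiffExpr_operatorA n γ ν f).ae_eq (hr.isDiffExpr n γ),
    (memLp_potential n hγ (f : L2)).coeFn_toLp] with x h1 h2 h3
  rw [h1, Pi.sub_apply, h2, potential, h3]
  ring

theorem IsRepr.inner_operatorA_sub_potential {n : ℕ} {γ ν : ℝ} (hγ : 0 < γ)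
    {f : (operatorA n γ ν).domain} {h : ℝ → ℝ} {c₁m c₂m c₁p c₂p : ℝ}
    (hr : IsRepr ν (f : L2) h c₁m c₂m c₁p c₂p) (g : L2) :
    ⟪operatorA n γ ν f - potential n hγ f, g⟫ =
      ∫ x, (-h x + (ν ^ 2 - 1 / 4) / x ^ 2 * prim (prim h) x) * g x ∂mu := by
  rw [inner_L2_eq]
  refine integral_congr_ae ?_
  filter_upwards [hr.operatorA_sub_potential_ae_eq hγ] with x hx
  rw [hx]

theorem isSelfAdjoint_operatorA (n : ℕ) {γ ν : ℝ} (hγ : 0 < γ) (hν : ν ∈ Ioo (0 : ℝ) 1) :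
    IsSelfAdjoint (operatorA n γ ν) := by
  have hdom := operatorA_domain n hγ ν
  have hrepr : ∀ f : (operatorA n γ ν).domain, ∃ (h : ℝ → ℝ) (c₁m c₂m c₁p c₂p : ℝ),
      IsRepr ν (f : L2) h c₁m c₂m c₁p c₂p := fun f =>
    exists_isRepr_of_mem_domainA (hdom.le f.2)
  have hk := isRepr_kernelFun hν
  refine isSelfAdjoint_of_symmetric_of_range _ (potential n hγ) (inner_potential_comm n hγ)
    (fun f g => ?_) ⟨(memLp_kernelFun hν).toLp _, hdom.ge (hk.mem_domainA hν)⟩ ?_ (fun w hw => ?_)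
  · obtain ⟨h, _, _, _, _, hf⟩ := hrepr f
    obtain ⟨k, _, _, _, _, hg⟩ := hrepr g
    rw [hf.inner_operatorA_sub_potential hγ, real_inner_comm,
      hg.inner_operatorA_sub_potential hγ, hf.integral_expr_mul_comm hν hg]
  · refine Lp.ext ?_
    have h0 : prim 0 = 0 := by ext x; simp [prim]
    filter_upwards [IsRepr.operatorA_sub_potential_ae_eq (n := n) hγ
      (f := ⟨(memLp_kernelFun hν).toLp _, hdom.ge (hk.mem_domainA hν)⟩) hk,
      Lp.coeFn_zero ℝ 2 mu] with x h1 h2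
    rw [h1, h2, h0, h0]
    simp
  · rw [real_inner_comm, inner_L2_eq] at hw
    have hw' : ∫ x, kernelFun ν x * w x ∂mu = 0 := by
      rw [← hw]
      refine integral_congr_ae ?_
      filter_upwards [(memLp_kernelFun hν).coeFn_toLp] with x hx
      rw [hx]
    obtain ⟨f, h, _, _, _, _, hr, hwf⟩ := exists_isRepr_of_integral_kernelFun_eq_zero hν w hw'
    refine ⟨⟨f, hdom.ge (hr.mem_domainA hν)⟩, Lp.ext ?_⟩
    exact (IsRepr.operatorA_sub_potential_ae_eq (n := n) hγ
      (f := ⟨f, hdom.ge (hr.mem_domainA hν)⟩) hr).trans hwf.symm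

theorem le_inner_operatorA (n : ℕ) {γ ν : ℝ} (hγ : 0 < γ) (hν : ν ∈ Ioo (0 : ℝ) 1)
    (f : (operatorA n γ ν).domain) {fr fs : L2} {c₁m c₂m c₁p c₂p : ℝ} {fr' : ℝ → ℝ}
    (hd : IsDecomposition ν f fr fs c₁m c₂m c₁p c₂p) (hw : HasWeakDerivOn (Ioo (-1) 1) fr fr') :
    min 1 (4 * ν ^ 2) * (∫ x in Ioo (-1 : ℝ) 1, fr' x ^ 2) +
        (n * Real.pi) ^ 2 * (∫ x in Ioo (-1 : ℝ) 1, |x| ^ (2 * γ) * (f : L2) x ^ 2) ≤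
      ⟪operatorA n γ ν f, (f : L2)⟫ := by
  obtain ⟨h, hfr, hr⟩ := hd.exists_isRepr
  have hG := continuous_prim (locallyIntegrable_of_memLp hr.memLp)
  -- Uniqueness of weak derivatives identifies any chosen derivative of the regular part with the
  -- primitive of `h`.
  have e1 : fr' =ᵐ[mu] prim h :=
    hw.ae_eq isOpen_Ioo (hasWeakDerivOn_prim hG.locallyIntegrable _) hfr
  have e2 : ∫ x in Ioo (-1 : ℝ) 1, fr' x ^ 2 = ∫ x, prim h x ^ 2 ∂mu := by
    refine integral_congr_ae ?_
    filter_upwards [e1] with x hx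
    rw [hx]
  have e3 : (n * Real.pi) ^ 2 * (∫ x in Ioo (-1 : ℝ) 1, |x| ^ (2 * γ) * (f : L2) x ^ 2) =
      ⟪potential n hγ f, (f : L2)⟫ := by
    rw [inner_potential, ← integral_const_mul]
    refine integral_congr_ae (Eventually.of_forall fun x => ?_)
    ring
  have e4 : ⟪operatorA n γ ν f, (f : L2)⟫ =
      ⟪operatorA n γ ν f - potential n hγ f, (f : L2)⟫ + ⟪potential n hγ f, (f : L2)⟫ := by
    rw [inner_sub_left, sub_add_cancel]
  rw [e2, e3, e4, hr.inner_operatorA_sub_potential hγ]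
  exact add_le_add_left (hr.le_integral_expr_mul hν) _

end SingularGrushin

end

theorem proposition2p1 (n : ℕ) (hn : 1 ≤ n) (γ ν : ℝ) (hγ : 0 < γ) (hν : ν ∈ Set.Ioo (0 : ℝ) 1) :
    -- `A_n` is a well-defined operator in `L²(-1, 1)` with domain exactly `D(A)`
    (SingularGrushin.operatorA n γ ν).domain = SingularGrushin.domainA ν ∧
    (∀ f : (SingularGrushin.operatorA n γ ν).domain,
      SingularGrushin.IsDiffExpr n γ ν (f : SingularGrushin.L2)
        (SingularGrushin.operatorA n γ ν f)) ∧
    -- it is self-adjoint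
    IsSelfAdjoint (SingularGrushin.operatorA n γ ν) ∧
    -- coercivity; `fr` is the regular part of `f` and `fr'` its weak derivative
    (∀ (f : (SingularGrushin.operatorA n γ ν).domain) (fr fs : SingularGrushin.L2)
      (c₁m c₂m c₁p c₂p : ℝ) (fr' : ℝ → ℝ),
      SingularGrushin.IsDecomposition ν f fr fs c₁m c₂m c₁p c₂p →
      SingularGrushin.HasWeakDerivOn (Set.Ioo (-1) 1) fr fr' →
      min 1 (4 * ν ^ 2) * (∫ x in Set.Ioo (-1 : ℝ) 1, fr' x ^ 2) +
          (n * Real.pi) ^ 2 * (∫ x in Set.Ioo (-1 : ℝ) 1,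
            |x| ^ (2 * γ) * ((f : SingularGrushin.L2) : ℝ → ℝ) x ^ 2) ≤
        inner ℝ (SingularGrushin.operatorA n γ ν f) (f : SingularGrushin.L2)) := by
  exact ⟨SingularGrushin.operatorA_domain n hγ ν, SingularGrushin.isDiffExpr_operatorA n γ ν,
    SingularGrushin.isSelfAdjoint_operatorA n hγ hν,
    fun f _ _ _ _ _ _ _ hd hw => SingularGrushin.le_inner_operatorA n hγ hν f hd hw⟩
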